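/- Let $N\subset\mathbb R^K$ be a smooth embedded submanifold with the induced metric, equipped with a smooth orthogonal almost complex structure $J$ ($J^2=-\mathrm{id}$) that is parallel for the Levi-Civita connection, so that $(N,J)$ is Kähler. Let $P(p):\mathbb R^K\to T_pN$ be the orthogonal projection. For a vector field $X$ along a map $u$ into $N$ write $\tilde\nabla_xX=P(u)\,\partial_xX$ and $\tilde\nabla_tX=P(u)\,\partial_tX$ (the pulled-back Levi-Civita connection), with $\tilde\nabla_xu=\partial_xu$, $\tilde\nabla_tu=\partial_tu$, and $\tau(u)=\tilde\nabla_x\partial_xu$. Let $I=[0,1]$, $k\in\mathbb N=\{0,1,2,\dots\}$, $\varepsilon\in[0,1]$, and let $u_0\in H^{2k+2}(I,N)$, that is, $u_0\in W^{2k+2,2}((0,1),\mathbb R^K)$, represented by its continuous representative on $I$, with $u_0(x)\in N$ for every $x\in I$. Let $u(t,x)=\sum_j V_j(x)\,t^j/j!$ be the formal solution in powers of $t$ of $$\tilde\nabla_tu=\varepsilon\,\tau(u)+J(u)\,\tau(u),\qquad u(0,\cdot)=u_0,$$ so that $V_0=u_0$ and, for $0\le j<k$, $V_{j+1}=\partial_t^{\,j}\big(\varepsilon\tau(u)+J(u)\tau(u)\big)\big|_{t=0}$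 is obtained from $V_0,\dots,V_j$ by differentiating the equation $j$ times in $t$. (To carry out these differentiations, $P$ and $J$ are extended smoothly to a neighbourhood of $N$ in $\mathbb R^K$; the $V_j$ do not depend on the extension.) Put $\tilde V_j=\tilde\nabla_t^{\,j}u|_{t=0}$, with $\tilde V_0=u_0$. We say that $u_0$ satisfies the compatibility condition of order $k$ for $\varepsilon$ if $\partial_xV_j=0$ on $\partial I=\{0,1\}$ for all $0\le j\le k$, and its intrinsic form if $\tilde\nabla_x\tilde V_j=0$ on $\partial I$ for all $0\le j\le k$. Then the compatibility condition of order $k$, and likewise its intrinsic form, holds if and only if $$\tilde\nabla_x^{\,2j+1}u_0=0\quad\text{on }\partial I\qquad\text{for all }0\le j\le k.$$ In particular, both forms of the condition are independent of $\varepsilon\in[0,1]$. -/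

import Mathlib

open Set MeasureTheory
open scoped ContDiff Nat

noncomputable section

namespace SchrodingerFlow

variable {E : Type*} [NormedAddCommGroup E] [InnerProductSpace ℝ E] [FiniteDimensional ℝ E]

/-- `N` is a smooth embedded submanifold of `E` (without boundary, of some dimension `d`): near each
of its points a smooth diffeomorphism between open subsets of `E` carries `N` to a `d`-dimensional
linear subspace. -/
def IsEmbeddedSubmanifold (N : Set E) : Prop :=
  ∃ d : ℕ, ∀ p ∈ N, ∃ (e : OpenPartialHomeomorph E E) (F : Submodule ℝ E),
    p ∈ e.source ∧ ContDiffOn ℝ ∞ e e.source ∧ ContDiffOn ℝ ∞ e.symm e.target ∧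
      Module.finrank ℝ F = d ∧ ∀ y ∈ e.source, (e y ∈ F ↔ y ∈ N)

/-- The tangent space `T_p N ⊆ E`: velocities at `p` of smooth curves in `N`. (For an embedded
submanifold these velocities already form a subspace, so that the span adds nothing.) -/
def tangentSpace (N : Set E) (p : E) : Submodule ℝ E :=
  Submodule.span ℝ {v | ∃ γ : ℝ → E, ContDiff ℝ ∞ γ ∧ (∀ t, γ t ∈ N) ∧ γ 0 = p ∧ deriv γ 0 = v}

/-- The orthogonal projection `P(p) : E → T_p N`. -/
def tangentProj (N : Set E) (p : E) : E →L[ℝ] E :=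
  (tangentSpace N p).starProjection

/-- `(N, J)` is a Kähler manifold whose metric is the one induced from `E`: `J` is a smooth almost
complex structure on `N`, orthogonal for the metric, and parallel for the Levi-Civita connection
(`∇ J = 0`). The Levi-Civita connection of the induced metric, along a curve `γ` in `N`, is
`∇_t X = P(γ) X'`. Only the restriction of `J p` to `T_p N`, for `p` in `N`, matters.
The Kähler form is `ω = ⟪J ·, ·⟫`. -/
structure IsKahlerSubmanifold (N : Set E) (J : E → E →L[ℝ] E) : Prop where
  submanifold : IsEmbeddedSubmanifold N
  smooth : ContDiffOn ℝ ∞ (fun y => (J y).comp (tangentProj N y)) N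
  mapsTo : ∀ p ∈ N, ∀ v ∈ tangentSpace N p, J p v ∈ tangentSpace N p
  sq_eq_neg : ∀ p ∈ N, ∀ v ∈ tangentSpace N p, J p (J p v) = -v
  orthogonal : ∀ p ∈ N, ∀ v ∈ tangentSpace N p, ∀ w ∈ tangentSpace N p,
    inner ℝ (J p v) (J p w) = inner ℝ v w
  parallel : ∀ γ X : ℝ → E, ContDiff ℝ ∞ γ → ContDiff ℝ ∞ X →
    (∀ t, γ t ∈ N) → (∀ t, X t ∈ tangentSpace N (γ t)) →
    ∀ t, tangentProj N (γ t) (deriv (fun s => J (γ s) (X s)) t)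
      = J (γ t) (tangentProj N (γ t) (deriv X t))

/-- `u ∈ H^m((0,1), E) = W^{m,2}((0,1), E)`: `u` is in `L²` and has weak derivatives in `L²` of all
orders up to `m`. -/
def MemSobolev (m : ℕ) (u : ℝ → E) : Prop :=
  MemLp u 2 (volume.restrict (Ioo (0 : ℝ) 1)) ∧
  ∀ j ≤ m, ∃ g : ℝ → E, MemLp g 2 (volume.restrict (Ioo (0 : ℝ) 1)) ∧
    ∀ η : ℝ → ℝ, ContDiff ℝ ∞ η → HasCompactSupport η → tsupport η ⊆ Ioo (0 : ℝ) 1 →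
      ∫ x in Ioo (0 : ℝ) 1, iteratedDeriv j η x • u x
        = (-1 : ℝ) ^ j • ∫ x in Ioo (0 : ℝ) 1, η x • g x

/-- `u ∈ H^m(I, N)`, `I = [0,1]`. An element of `H^m`, `m ≥ 1`, is represented by its (unique)
representative that is continuous on `[0,1]`; values of `u` outside `[0,1]` play no role. -/
def MemSobolevMaps (m : ℕ) (N : Set E) (u : ℝ → E) : Prop :=
  MemSobolev m u ∧ ContinuousOn u (Icc 0 1) ∧ ∀ x ∈ Icc (0 : ℝ) 1, u x ∈ N

/-- The derivative `∂_x` on `I = [0,1]`, one-sided at the two boundary points. -/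
def dx (f : ℝ → E) : ℝ → E := derivWithin f (Icc 0 1)

/-- Iterated covariant derivatives `∇^n c` of a curve `c` with parameter in `S ⊆ ℝ`, for the field
of projections `P`: `∇^0 c = c`, `∇^1 c = c'`, `∇^{n+2} c = P(c) (∇^{n+1} c)'`. -/
def covDerivIter (P : E → E →L[ℝ] E) (S : Set ℝ) (c : ℝ → E) : ℕ → ℝ → E
  | 0 => c
  | 1 => derivWithin c S
  | n + 2 => fun s => P (c s) (derivWithin (covDerivIter P S c (n + 1)) S s)

/-- `∇_x^n u` for a map `u : [0,1] → N`. -/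
def covDx (N : Set E) (u : ℝ → E) (n : ℕ) : ℝ → E :=
  covDerivIter (tangentProj N) (Icc 0 1) u n

/-- `P'` and `J'` are smooth in a neighbourhood of `N` in `E`, and for `p ∈ N` the operator `P' p`
is the projection to `T_p N` and `J' p` agrees with `J p` on `T_p N`. Such extensions off `N` are
used only to differentiate `P(u)` and `J(u)` along Taylor polynomials in `t`. These polynomials are
tangent to `N` to the order to which they are differentiated, so that the formal time derivatives
below do not depend on the choice of the extensions. -/
def IsSmoothExtension (N : Set E) (J P' J' : E → E →L[ℝ] E) : Prop :=
  (∃ U : Set E, IsOpen U ∧ N ⊆ U ∧ ContDiffOn ℝ ∞ P' U ∧ ContDiffOn ℝ ∞ J' U) ∧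
  (∀ p ∈ N, P' p = tangentProj N p) ∧
  (∀ p ∈ N, ∀ v ∈ tangentSpace N p, J' p v = J p v)

/-- The right-hand side `ε τ(u) + J(u) τ(u)` of the flow, in terms of `y = u` and `w = ∂_x² u`;
the tension field is `τ(u) = ∇_x ∂_x u = P(u) ∂_x² u`. -/
def flowRHS (P' J' : E → E →L[ℝ] E) (ε : ℝ) (y w : E) : E :=
  ε • P' y w + J' y (P' y w)

/-- The Taylor polynomial of degree `n` in `t` of the formal solution
`u(t, x) = ∑ V_j(x) t^j / j!` of `∂_t u = ε τ(u) + J(u) τ(u)`, `u(0, ·) = u₀`. The equation,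
differentiated `n` times in `t` at `t = 0`, gives the coefficient `V_{n+1}` in terms of
`V_0, …, V_n`. -/
def formalSolution (P' J' : E → E →L[ℝ] E) (ε : ℝ) (u₀ : ℝ → E) : ℕ → ℝ → ℝ → E
  | 0 => fun _ x => u₀ x
  | n + 1 => fun t x => formalSolution P' J' ε u₀ n t x + (t ^ (n + 1) / ((n + 1)! : ℝ)) •
      iteratedDeriv n (fun s => flowRHS P' J' ε (formalSolution P' J' ε u₀ n s x)
        (dx (dx (formalSolution P' J' ε u₀ n s)) x)) 0

/-- `V_j(u₀) = ∂_t^j u |_{t=0}`. -/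
def timeDeriv (P' J' : E → E →L[ℝ] E) (ε : ℝ) (u₀ : ℝ → E) (j : ℕ) (x : ℝ) : E :=
  iteratedDeriv j (fun t => formalSolution P' J' ε u₀ j t x) 0

/-- `Ṽ_j(u₀) = ∇_t^j u |_{t=0}`, where `∇_t^0 u = u`, `∇_t^1 u = ∂_t u`, and
`∇_t X = P(u) ∂_t X`. -/
def covTimeDeriv (P' J' : E → E →L[ℝ] E) (ε : ℝ) (u₀ : ℝ → E) (j : ℕ) (x : ℝ) : E :=
  covDerivIter P' univ (fun t => formalSolution P' J' ε u₀ j t x) j 0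

/-- The compatibility condition of order `k` for `∂_t u = ε τ(u) + J(u) τ(u)`:
`∂_x V_j = 0` on `∂I = {0, 1}` for all `j ≤ k`. -/
def Compatible (N : Set E) (J : E → E →L[ℝ] E) (ε : ℝ) (k : ℕ) (u₀ : ℝ → E) : Prop :=
  ∀ P' J' : E → E →L[ℝ] E, IsSmoothExtension N J P' J' →
    ∀ j ≤ k, ∀ x ∈ ({0, 1} : Set ℝ), dx (timeDeriv P' J' ε u₀ j) x = 0

/-- The intrinsic form of the compatibility condition of order `k`: `∇_x Ṽ_j = 0` on `∂I = {0, 1}`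
for all `j ≤ k`. Here `∇_x X = P(u₀) ∂_x X`; for `j = 0` this is `P(u₀) ∂_x u₀ = ∂_x u₀`. -/
def CovCompatible (N : Set E) (J : E → E →L[ℝ] E) (ε : ℝ) (k : ℕ) (u₀ : ℝ → E) : Prop :=
  ∀ P' J' : E → E →L[ℝ] E, IsSmoothExtension N J P' J' →
    ∀ j ≤ k, ∀ x ∈ ({0, 1} : Set ℝ),
      tangentProj N (u₀ x) (dx (covTimeDeriv P' J' ε u₀ j) x) = 0

end SchrodingerFlow

end

/-! Everything happens in the jets at one boundary point $x_0$. Call a jet even if its odd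
derivatives vanish. Smooth functions of even jets are even (`EvenTo.comp`), and an even family of
operators acts on the leading odd derivative of a jet only through its value at $x_0$
(`HasJet.clm_apply`).

Suppose the odd derivatives of $u_0$ of order below $2m+1$ vanish at $x_0$, and let
$r=\partial_x^{2m+1}u_0(x_0)$. Differentiating $\partial_tu=A(u)\,\partial_x^2u$ with $A=\varepsilon
P+JP$, each step in $t$ costs two derivatives in $x$ and applies $A(u_0(x_0))$ once to the leading
derivative; every other Leibniz term dies by parity. Hence $\partial_xV_m=A^mr$ (`dx_timeDeriv`),
$\partial_x\tilde V_m=P^{m-1}A^mr$ (`dx_covTimeDeriv`) and $\tilde\nabla_x^{2m+1}u_0=r$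
(`hasJet_covDerivIter`).

Moreover $r$ is tangent to $N$ (`HasJet.mem_tangentSpace`), where $P$ is the identity and
$A=\varepsilon+J$ is injective because $J^2=-1$ (`flowOp_pow_eq_zero_iff`). So all three quantities
vanish exactly when $r=0$, and induction on $m$ finishes (`forall_eq_zero_iff_odd_derivs`). Two side
facts are needed: $H^{2k+2}\subset C^{2k+1}$ on $[0,1]$, and the existence of smooth extensions of
$P$ and $J$. -/

namespace SchrodingerFlow

/-! ### Parity of jets at a point and the Leibniz rule. -/

section Jets

variable {F G H : Type*} [NormedAddCommGroup F] [NormedSpace ℝ F] [NormedAddCommGroup G]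
  [NormedSpace ℝ G] [NormedAddCommGroup H] [NormedSpace ℝ H] {S : Set ℝ} {x₀ : ℝ}

/-- The Leibniz rule for the application of a family of operators to a family of vectors. -/
theorem iteratedDerivWithin_clm_apply (hS : UniqueDiffOn ℝ S) {n : ℕ} {f : ℝ → F →L[ℝ] G}
    {g : ℝ → F} {x : ℝ} (hx : x ∈ S) (hf : ContDiffOn ℝ n f S) (hg : ContDiffOn ℝ n g S) :
    iteratedDerivWithin n (fun y => f y (g y)) S x = ∑ i ∈ Finset.range (n + 1),
      n.choose i • iteratedDerivWithin i f S x (iteratedDerivWithin (n - i) g S x) := by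
  induction n generalizing f g with
  | zero => simp
  | succ n IH =>
    have hf' : ContDiffOn ℝ n (derivWithin f S) S := hf.derivWithin hS (by simp)
    have hg' : ContDiffOn ℝ n (derivWithin g S) S := hg.derivWithin hS (by simp)
    have hf0 : ContDiffOn ℝ n f S := hf.of_le (by simp)
    have hg0 : ContDiffOn ℝ n g S := hg.of_le (by simp)
    have hd : EqOn (derivWithin (fun y => f y (g y)) S)
        (fun y => f y (derivWithin g S y) + derivWithin f S y (g y)) S := by
      intro y hy
      have h1 := ((hf.differentiableOn (by simp)) y hy).hasDerivWithinAt
      have h2 := ((hg.differentiableOn (by simp)) y hy).hasDerivWithinAt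
      simpa [add_comm] using (h1.clm_apply h2).derivWithin (hS y hy)
    rw [iteratedDerivWithin_succ', iteratedDerivWithin_congr hd hx, Finset.sum_range_succ',
      iteratedDerivWithin_fun_add hx hS ((hf0.clm_apply hg') x hx) ((hf'.clm_apply hg0) x hx),
      IH hf0 hg', Finset.sum_range_succ', IH hf' hg0]
    simp only [Nat.choose_succ_succ', add_smul, Finset.sum_add_distrib]
    nth_rw 3 [Finset.sum_range_succ]
    have : ∀ i ∈ Finset.range n, 1 ≤ n - i := by simp; lia
    simp +contextual [← iteratedDerivWithin_succ', ← n.sub_sub, Nat.sub_add_cancel, this]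
    abel

/-- `f` is of class `C^q` on `S` and its derivatives of odd order `≤ q` vanish at `x₀`. -/
def EvenTo (S : Set ℝ) (x₀ : ℝ) (q : ℕ) (f : ℝ → F) : Prop :=
  ContDiffOn ℝ q f S ∧ ∀ i ≤ q, Odd i → iteratedDerivWithin i f S x₀ = 0

/-- `f` is of class `C^q` on `S`; at `x₀`, its derivatives of order `i < q` with `i` of the parity
of `q` vanish, and its derivative of order `q` is `r`. -/
def HasJet (S : Set ℝ) (x₀ : ℝ) (q : ℕ) (f : ℝ → F) (r : F) : Prop :=
  ContDiffOn ℝ q f S ∧ (∀ i < q, Even (q - i) → iteratedDerivWithin i f S x₀ = 0) ∧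
    iteratedDerivWithin q f S x₀ = r

theorem EvenTo.mono {p q : ℕ} {f : ℝ → F} (h : EvenTo S x₀ q f) (hpq : p ≤ q) :
    EvenTo S x₀ p f :=
  ⟨h.1.of_le (by exact_mod_cast hpq), fun i hi => h.2 i (hi.trans hpq)⟩

theorem HasJet.evenTo {p q : ℕ} {f : ℝ → F} {r : F} (h : HasJet S x₀ q f r) (hq : Odd q)
    (hpq : p < q) : EvenTo S x₀ p f :=
  ⟨h.1.of_le (by exact_mod_cast hpq.le),
    fun i hi ho => h.2.1 i (hi.trans_lt hpq) (Nat.Odd.sub_odd hq ho)⟩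

/-- For odd order, an even jet is the same as a `HasJet` with zero top derivative; this and
`HasJet.evenTo_self` pass between the two notions. -/
theorem EvenTo.hasJet_zero {q : ℕ} {f : ℝ → F} (h : EvenTo S x₀ q f) (hq : Odd q) :
    HasJet S x₀ q f 0 :=
  ⟨h.1, fun i hi he => h.2 i hi.le (by
    rcases Nat.even_or_odd i with hi' | hi'
    · exact absurd (Nat.Odd.sub_even hi.le hq hi') (by simpa using he)
    · exact hi'), h.2 q le_rfl hq⟩

theorem HasJet.evenTo_self {q : ℕ} {f : ℝ → F} (h : HasJet S x₀ q f 0) (hq : Odd q) :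
    EvenTo S x₀ q f :=
  ⟨h.1, fun i hi ho => by
    rcases hi.eq_or_lt with rfl | hi
    · exact h.2.2
    · exact h.2.1 i hi (Nat.Odd.sub_odd hq ho)⟩

theorem HasJet.derivWithin (hS : UniqueDiffOn ℝ S) {q : ℕ} {f : ℝ → F} {r : F}
    (h : HasJet S x₀ (q + 1) f r) : HasJet S x₀ q (derivWithin f S) r := by
  refine ⟨h.1.derivWithin hS (by simp), fun i hi he => ?_, ?_⟩
  · rw [← iteratedDerivWithin_succ']
    exact h.2.1 (i + 1) (by omega) (by simpa using he)
  · rw [← iteratedDerivWithin_succ']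
    exact h.2.2

/-- Lowering the order by a positive even number kills the top derivative. -/
theorem HasJet.sub_two_mul {p q : ℕ} {f : ℝ → F} {r : F} (h : HasJet S x₀ q f r) (hpq : p < q)
    (he : Even (q - p)) : HasJet S x₀ p f 0 := by
  refine ⟨h.1.of_le (by exact_mod_cast hpq.le), fun i hi hi' => h.2.1 i (hi.trans hpq) ?_,
    h.2.1 p hpq he⟩
  have : q - i = (q - p) + (p - i) := by omega
  rw [this]; exact he.add hi'

theorem HasJet.congr {q : ℕ} {f g : ℝ → F} {r : F} (hx : x₀ ∈ S) (h : HasJet S x₀ q f r)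
    (hfg : EqOn g f S) : HasJet S x₀ q g r :=
  ⟨h.1.congr hfg, fun i hi he => (iteratedDerivWithin_congr hfg hx).trans (h.2.1 i hi he),
    (iteratedDerivWithin_congr hfg hx).trans h.2.2⟩

theorem HasJet.add (hS : UniqueDiffOn ℝ S) (hx : x₀ ∈ S) {q : ℕ} {f g : ℝ → F} {r r' : F}
    (h : HasJet S x₀ q f r) (h' : HasJet S x₀ q g r') :
    HasJet S x₀ q (fun x => f x + g x) (r + r') := by
  have key : ∀ i ≤ q, iteratedDerivWithin i (fun x => f x + g x) S x₀ =
      iteratedDerivWithin i f S x₀ + iteratedDerivWithin i g S x₀ := fun i hi =>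
    iteratedDerivWithin_fun_add hx hS ((h.1.of_le (by exact_mod_cast hi)) x₀ hx)
      ((h'.1.of_le (by exact_mod_cast hi)) x₀ hx)
  refine ⟨h.1.add h'.1, fun i hi he => ?_, ?_⟩
  · rw [key i hi.le, h.2.1 i hi he, h'.2.1 i hi he, add_zero]
  · rw [key q le_rfl, h.2.2, h'.2.2]

theorem hasJet_zero {q : ℕ} : HasJet S x₀ q (fun _ => (0 : F)) 0 :=
  ⟨contDiffOn_const, by simp, by simp⟩

theorem HasJet.sum (hS : UniqueDiffOn ℝ S) (hx : x₀ ∈ S) {q : ℕ} {ι : Type*} (t : Finset ι)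
    {f : ι → ℝ → F} {r : ι → F} (h : ∀ i ∈ t, HasJet S x₀ q (f i) (r i)) :
    HasJet S x₀ q (fun x => ∑ i ∈ t, f i x) (∑ i ∈ t, r i) := by
  classical
  induction t using Finset.induction_on with
  | empty => simpa using hasJet_zero
  | insert a t ha ih =>
    simp only [Finset.sum_insert ha]
    exact (h a (by simp)).add hS hx (ih fun i hi => h i (by simp [hi]))

theorem HasJet.const_smul {q : ℕ} {f : ℝ → F} {r : F}
    (c : ℝ) (h : HasJet S x₀ q f r) : HasJet S x₀ q (fun x => c • f x) (c • r) := by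
  refine ⟨h.1.const_smul c, fun i hi he => ?_, ?_⟩
  · rw [iteratedDerivWithin_fun_const_smul_field, h.2.1 i hi he, smul_zero]
  · rw [iteratedDerivWithin_fun_const_smul_field, h.2.2]

/-- In the Leibniz sum at an order of the parity of $q$, odd derivatives fall on the even factor `f`
and vanish; a positive even number of them leaves a derivative of `g` of lower order and the same
parity, which vanishes too. Only the undifferentiated `f` survives. -/
theorem HasJet.clm_apply (hS : UniqueDiffOn ℝ S) (hx : x₀ ∈ S) {q : ℕ} {f : ℝ → F →L[ℝ] G}
    {g : ℝ → F} {r : F} (hf : EvenTo S x₀ q f) (hg : HasJet S x₀ q g r) :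
    HasJet S x₀ q (fun x => f x (g x)) (f x₀ r) := by
  have key : ∀ i ≤ q, Even (q - i) → iteratedDerivWithin i (fun x => f x (g x)) S x₀ =
      f x₀ (iteratedDerivWithin i g S x₀) := by
    intro i hi he
    rw [iteratedDerivWithin_clm_apply hS hx (hf.1.of_le (by exact_mod_cast hi))
      (hg.1.of_le (by exact_mod_cast hi)), Finset.sum_eq_single 0]
    · simp
    · intro l hl hl0
      have hl' : l ≤ i := by simpa [Nat.lt_succ_iff] using hl
      rcases Nat.even_or_odd l with hle | hlo
      · rw [hg.2.1 (i - l) (by omega), map_zero, smul_zero]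
        have : q - (i - l) = (q - i) + l := by omega
        rw [this]; exact he.add hle
      · rw [hf.2 l (hl'.trans hi) hlo]; simp
    · simp
  refine ⟨hf.1.clm_apply hg.1, fun i hi he => ?_, ?_⟩
  · rw [key i hi.le he, hg.2.1 i hi he, map_zero]
  · rw [key q le_rfl (by simp), hg.2.2]

/-- Bundles finitely many Taylor coefficients into one even curve, so that `EvenTo.comp` applies to
functions of all of them. -/
theorem EvenTo.pi {ι : Type*} [Fintype ι] (hx : x₀ ∈ S) (hS : UniqueDiffOn ℝ S) {q : ℕ}
    {f : ι → ℝ → F} (h : ∀ i, EvenTo S x₀ q (f i)) : EvenTo S x₀ q (fun x i => f i x) := by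
  have hc : ContDiffOn ℝ q (fun x i => f i x) S := contDiffOn_pi.2 fun i => (h i).1
  refine ⟨hc, fun n hn ho => ?_⟩
  have key : ∀ m ≤ q, ∀ x ∈ S, iteratedDerivWithin m (fun x i => f i x) S x =
      fun i => iteratedDerivWithin m (f i) S x := by
    intro m
    induction m with
    | zero => intros; rfl
    | succ m ih =>
      intro hm x hxS
      rw [iteratedDerivWithin_succ, derivWithin_congr (ih (by omega)) (ih (by omega) x hxS)]
      refine HasDerivWithinAt.derivWithin (hasDerivWithinAt_pi.2 fun i => ?_) (hS x hxS)
      rw [iteratedDerivWithin_succ]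
      exact ((h i).1.differentiableOn_iteratedDerivWithin (by exact_mod_cast hm) hS x
        hxS).hasDerivWithinAt
  rw [key n hn x₀ hx]
  funext i
  exact (h i).2 n hn ho

end Jets

/-! ### Smooth functions of even jets. -/

section Composition

universe v

variable {S : Set ℝ} {x₀ : ℝ}

/-- Chain rule and induction: $(g\circ f)'=Dg(f)\,f'$, where $Dg(f)$ is even by induction and $f'$
has vanishing even derivatives. The induction replaces `G` by `F →L[ℝ] G`, which is why both spaces
share a universe. -/
theorem EvenTo.comp {F G : Type v} [NormedAddCommGroup F] [NormedSpace ℝ F] [NormedAddCommGroup G]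
    [NormedSpace ℝ G] (hS : UniqueDiffOn ℝ S) (hx : x₀ ∈ S) {q : ℕ} {f : ℝ → F} {g : F → G}
    {U : Set F} (hU : IsOpen U) (hg : ContDiffOn ℝ ∞ g U) (hfU : MapsTo f S U)
    (hf : EvenTo S x₀ q f) : EvenTo S x₀ q (fun x => g (f x)) := by
  induction q using Nat.strong_induction_on generalizing G with
  | _ q ih =>
    have hcont : ContDiffOn ℝ q (fun x => g (f x)) S :=
      (hg.of_le (by exact_mod_cast le_top)).comp hf.1 hfU
    refine ⟨hcont, fun i hi ho => ?_⟩
    obtain ⟨n, rfl⟩ : ∃ n, i = n + 1 := ⟨i - 1, by have := ho.pos; omega⟩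
    have hd : EqOn (derivWithin (fun x => g (f x)) S)
        (fun x => fderiv ℝ g (f x) (derivWithin f S x)) S := by
      intro x hxS
      have h1 : DifferentiableAt ℝ g (f x) :=
        (hg.contDiffAt (hU.mem_nhds (hfU hxS))).differentiableAt (by simp)
      have h2 : DifferentiableWithinAt ℝ f S x :=
        hf.1.differentiableOn (by norm_cast; omega) x hxS
      exact (h1.hasFDerivAt.comp_hasDerivWithinAt x h2.hasDerivWithinAt).derivWithin (hS x hxS)
    rw [iteratedDerivWithin_succ', iteratedDerivWithin_congr hd hx]
    have h1 : EvenTo S x₀ n (fun x => fderiv ℝ g (f x)) :=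
      ih n (by omega) (hg.fderiv_of_isOpen hU (by simp)) (hf.mono (by omega))
    have h2 : HasJet S x₀ n (derivWithin f S) 0 := ((hf.mono hi).hasJet_zero ho).derivWithin hS
    simpa using (h2.clm_apply hS hx h1).2.2

end Composition

/-! ### Smooth dependence of time derivatives on parameters. -/

section Parametric

variable {X G : Type*} [NormedAddCommGroup X] [NormedSpace ℝ X] [NormedAddCommGroup G]
  [NormedSpace ℝ G]

theorem contDiffOn_deriv_param {g : X × ℝ → G} {O : Set (X × ℝ)} (hO : IsOpen O)
    (hg : ContDiffOn ℝ ∞ g O) :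
    ContDiffOn ℝ ∞ (fun p : X × ℝ => deriv (fun t => g (p.1, t)) p.2) O := by
  have h1 : ContDiffOn ℝ ∞ (fun p : X × ℝ => fderiv ℝ g p ((0 : X), (1 : ℝ))) O :=
    (hg.fderiv_of_isOpen hO (by simp)).clm_apply contDiffOn_const
  refine h1.congr fun p hp => ?_
  have h2 : HasFDerivAt g (fderiv ℝ g p) (p.1, p.2) :=
    ((hg.contDiffAt (hO.mem_nhds hp)).differentiableAt (by simp)).hasFDerivAt
  have h3 : HasDerivAt (fun t : ℝ => (p.1, t)) ((0 : X), (1 : ℝ)) p.2 :=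
    (hasDerivAt_const _ _).prodMk (hasDerivAt_id _)
  exact (h2.comp_hasDerivAt p.2 h3).deriv

theorem contDiffOn_iteratedDeriv_param {g : X × ℝ → G} {O : Set (X × ℝ)} (hO : IsOpen O)
    (hg : ContDiffOn ℝ ∞ g O) (i : ℕ) :
    ContDiffOn ℝ ∞ (fun p : X × ℝ => iteratedDeriv i (fun t => g (p.1, t)) p.2) O := by
  induction i with
  | zero => simpa using hg
  | succ i ih =>
    simp only [iteratedDeriv_succ]
    exact contDiffOn_deriv_param hO ih

end Parametric

/-! ### Taylor polynomials in time. -/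

section TimePolynomial

variable {F : Type*} [NormedAddCommGroup F] [NormedSpace ℝ F]

/-- The polynomial in `t` with derivatives `V 0, …, V j` at `t = 0`. -/
noncomputable def timePoly {j : ℕ} (V : Fin (j + 1) → F) (t : ℝ) : F :=
  ∑ l : Fin (j + 1), (t ^ (l : ℕ) / ((l : ℕ)! : ℝ)) • V l

theorem contDiff_timePoly_uncurry (j : ℕ) :
    ContDiff ℝ ∞ (fun p : (Fin (j + 1) → F) × ℝ => timePoly p.1 p.2) := by
  unfold timePoly
  fun_prop

theorem contDiff_timePoly {j : ℕ} (V : Fin (j + 1) → F) : ContDiff ℝ ∞ (timePoly V) := by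
  unfold timePoly
  fun_prop

theorem timePoly_zero {j : ℕ} (V : Fin (j + 1) → F) : timePoly V 0 = V 0 := by
  unfold timePoly
  rw [Finset.sum_eq_single 0]
  · simp
  · intro l _ hl
    have : (l : ℕ) ≠ 0 := fun h => hl (Fin.ext h)
    simp [this]
  · simp

theorem iteratedDeriv_timePoly {j : ℕ} (V : Fin (j + 1) → F) (i : Fin (j + 1)) :
    iteratedDeriv i (timePoly V) 0 = V i := by
  unfold timePoly
  rw [iteratedDeriv_fun_sum fun l _ => by fun_prop, Finset.sum_eq_single i]
  · rw [iteratedDeriv_smul_const (by fun_prop)]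
    simp only [div_eq_mul_inv]
    rw [iteratedDeriv_mul_const_field, iteratedDeriv_fun_pow_zero]
    simp [Nat.factorial_ne_zero]
  · intro l _ hl
    have : (i : ℕ) ≠ l := fun h => hl (Fin.ext h.symm)
    rw [iteratedDeriv_smul_const (by fun_prop)]
    simp only [div_eq_mul_inv]
    rw [iteratedDeriv_mul_const_field, iteratedDeriv_fun_pow_zero]
    simp [this]
  · simp

/-- The Taylor coefficients of `A` along a polynomial depend smoothly on its coefficients. -/
theorem contDiffOn_iteratedDeriv_comp_timePoly {G : Type*} [NormedAddCommGroup G]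
    [NormedSpace ℝ G] {A : F → G} {U : Set F} (hU : IsOpen U)
    (hA : ContDiffOn ℝ ∞ A U) (j i : ℕ) :
    ContDiffOn ℝ ∞ (fun V : Fin (j + 1) → F => iteratedDeriv i (fun t => A (timePoly V t)) 0)
      {V | V 0 ∈ U} := by
  have hc := contDiff_timePoly_uncurry (F := F) j
  have hO : IsOpen ((fun p : (Fin (j + 1) → F) × ℝ => timePoly p.1 p.2) ⁻¹' U) :=
    hU.preimage hc.continuous
  have h1 := contDiffOn_iteratedDeriv_param hO
    (g := fun p : (Fin (j + 1) → F) × ℝ => A (timePoly p.1 p.2))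
    (hA.comp hc.contDiffOn (mapsTo_preimage _ _)) i
  have h2 : ContDiffOn ℝ ∞ (fun V : Fin (j + 1) → F => (V, (0 : ℝ))) {V | V 0 ∈ U} :=
    (contDiff_id.prodMk contDiff_const).contDiffOn
  exact h1.comp h2 fun V hV => by simpa [timePoly_zero] using hV

end TimePolynomial

/-! ### Iterated covariant derivatives along Taylor polynomials. -/

section CovariantIterates

universe v

variable {E : Type v} [NormedAddCommGroup E] [InnerProductSpace ℝ E]

theorem contDiffOn_covDerivIter {P : E → E →L[ℝ] E} {U : Set E} (hP : ContDiffOn ℝ ∞ P U)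
    {S : Set ℝ} (hS : UniqueDiffOn ℝ S) {c : ℝ → E} (hc : ContDiffOn ℝ ∞ c S)
    (hcU : MapsTo c S U) : ∀ n, ContDiffOn ℝ ∞ (covDerivIter P S c n) S
  | 0 => hc
  | 1 => hc.derivWithin hS (by simp)
  | n + 2 => (hP.comp hc hcU).clm_apply
      ((contDiffOn_covDerivIter hP hS hc hcU (n + 1)).derivWithin hS (by simp))

theorem covDerivIter_univ_eqOn {P : E → E →L[ℝ] E} {S : Set ℝ} (hS : IsOpen S) (c : ℝ → E) :
    ∀ n, EqOn (covDerivIter P univ c n) (covDerivIter P S c n) S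
  | 0 => fun _ _ => rfl
  | 1 => fun t ht => by
      simp [covDerivIter, derivWithin_of_isOpen hS ht]
  | n + 2 => fun t ht => by
      have h := covDerivIter_univ_eqOn (P := P) hS c (n + 1)
      have h1 := (h.eventuallyEq_of_mem (hS.mem_nhds ht)).deriv_eq
      simp only [covDerivIter, derivWithin_univ, derivWithin_of_isOpen hS ht]
      rw [h1]

/-- `∇^n` of a curve `c` is smooth in the parameter and in the coefficients of the curve. -/
theorem contDiffOn_covDerivIter_timePoly {P : E → E →L[ℝ] E} {U : Set E} (hU : IsOpen U)
    (hP : ContDiffOn ℝ ∞ P U) (j n : ℕ) :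
    ContDiffOn ℝ ∞ (fun V : Fin (j + 1) → E => covDerivIter P univ (timePoly V) n 0)
      {V | V 0 ∈ U} := by
  have hc := contDiff_timePoly_uncurry (F := E) j
  set O := (fun p : (Fin (j + 1) → E) × ℝ => timePoly p.1 p.2) ⁻¹' U with hOdef
  have hO : IsOpen O := hU.preimage hc.continuous
  have key : ∀ n, ContDiffOn ℝ ∞ (fun p : (Fin (j + 1) → E) × ℝ =>
      covDerivIter P univ (timePoly p.1) n p.2) O := by
    intro n
    induction n with
    | zero => exact hc.contDiffOn
    | succ n ih =>
      cases n with
      | zero =>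
        simp only [covDerivIter, derivWithin_univ]
        exact contDiffOn_deriv_param hO ih
      | succ n =>
        simp only [covDerivIter, derivWithin_univ]
        exact (hP.comp hc.contDiffOn (mapsTo_preimage _ _)).clm_apply
          (contDiffOn_deriv_param hO ih)
  have h2 : ContDiffOn ℝ ∞ (fun V : Fin (j + 1) → E => (V, (0 : ℝ))) {V | V 0 ∈ U} :=
    (contDiff_id.prodMk contDiff_const).contDiffOn
  exact (key n).comp h2 fun V hV => by simpa [hOdef, timePoly_zero] using hV

/-- The derivatives of order `≤ q` of `g ∘ c` depend only on those of `c`. -/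
theorem iteratedDerivWithin_comp_congr {F G : Type v} [NormedAddCommGroup F] [NormedSpace ℝ F]
    [NormedAddCommGroup G] [NormedSpace ℝ G] {S : Set ℝ} {x₀ : ℝ} (hS : UniqueDiffOn ℝ S)
    (hx : x₀ ∈ S) {g : F → G} {U : Set F} (hU : IsOpen U) (hg : ContDiffOn ℝ ∞ g U)
    {c₁ c₂ : ℝ → F} (hc₁ : ContDiffOn ℝ ∞ c₁ S) (hc₂ : ContDiffOn ℝ ∞ c₂ S)
    (h₁ : MapsTo c₁ S U) (h₂ : MapsTo c₂ S U) {q : ℕ}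
    (h : ∀ i ≤ q, iteratedDerivWithin i c₁ S x₀ = iteratedDerivWithin i c₂ S x₀) :
    iteratedDerivWithin q (fun x => g (c₁ x)) S x₀ =
      iteratedDerivWithin q (fun x => g (c₂ x)) S x₀ := by
  induction q using Nat.strong_induction_on generalizing G with
  | _ q ih =>
    cases q with
    | zero => simpa using congrArg g (h 0 le_rfl)
    | succ n =>
      have hd : ∀ c : ℝ → F, ContDiffOn ℝ ∞ c S → MapsTo c S U →
          iteratedDerivWithin (n + 1) (fun x => g (c x)) S x₀ =
            ∑ i ∈ Finset.range (n + 1), n.choose i •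
              iteratedDerivWithin i (fun x => fderiv ℝ g (c x)) S x₀
                (iteratedDerivWithin (n - i + 1) c S x₀) := by
        intro c hc hcU
        have hd : EqOn (derivWithin (fun x => g (c x)) S)
            (fun x => fderiv ℝ g (c x) (derivWithin c S x)) S := by
          intro x hxS
          have h1 : DifferentiableAt ℝ g (c x) :=
            (hg.contDiffAt (hU.mem_nhds (hcU hxS))).differentiableAt (by simp)
          have h2 : DifferentiableWithinAt ℝ c S x := hc.differentiableOn (by simp) x hxS
          exact (h1.hasFDerivAt.comp_hasDerivWithinAt x h2.hasDerivWithinAt).derivWithin (hS x hxS)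
        have hf : ContDiffOn ℝ ∞ (fun x => fderiv ℝ g (c x)) S :=
          (hg.fderiv_of_isOpen hU (by simp)).comp hc hcU
        rw [iteratedDerivWithin_succ', iteratedDerivWithin_congr hd hx,
          iteratedDerivWithin_clm_apply hS hx (hf.of_le (by exact_mod_cast le_top))
            ((hc.derivWithin (m := ∞) hS (by simp)).of_le (by exact_mod_cast le_top))]
        simp only [← iteratedDerivWithin_succ']
      rw [hd c₁ hc₁ h₁, hd c₂ hc₂ h₂]
      refine Finset.sum_congr rfl fun i hi => ?_
      have hi' : i ≤ n := by simpa [Nat.lt_succ_iff] using hi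
      rw [h _ (by omega), ih i (by omega) (hg.fderiv_of_isOpen hU (by simp))
        fun l hl => h l (by omega)]

/-- Two curves that agree at `x₀` to order `j - 1`: the difference of the covariant derivatives
of order `j` is controlled by that of the ordinary derivatives of order `j`. -/
theorem iteratedDerivWithin_covDerivIter_sub {P : E → E →L[ℝ] E} {U : Set E} (hU : IsOpen U)
    (hP : ContDiffOn ℝ ∞ P U) {S : Set ℝ} {x₀ : ℝ} (hS : UniqueDiffOn ℝ S) (hx : x₀ ∈ S)
    {c₁ c₂ : ℝ → E} (hc₁ : ContDiffOn ℝ ∞ c₁ S) (hc₂ : ContDiffOn ℝ ∞ c₂ S)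
    (h₁ : MapsTo c₁ S U) (h₂ : MapsTo c₂ S U) {j : ℕ}
    (h : ∀ i < j, iteratedDerivWithin i c₁ S x₀ = iteratedDerivWithin i c₂ S x₀) (n : ℕ) :
    ∀ i, i + (n + 1) ≤ j → iteratedDerivWithin i (covDerivIter P S c₂ (n + 1)) S x₀ -
        iteratedDerivWithin i (covDerivIter P S c₁ (n + 1)) S x₀ =
      if i + (n + 1) = j then
        ((P (c₁ x₀)) ^ n) (iteratedDerivWithin j c₂ S x₀ - iteratedDerivWithin j c₁ S x₀)
      else 0 := by
  induction n with
  | zero =>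
    intro i hi
    simp only [zero_add, covDerivIter, ← iteratedDerivWithin_succ', pow_zero,
      one_apply_eq_self] at hi ⊢
    split_ifs with hij
    · rw [hij]
    · rw [h (i + 1) (by omega), sub_self]
  | succ n ih =>
    intro i hi
    have hd : ∀ c : ℝ → E, ContDiffOn ℝ ∞ c S → MapsTo c S U →
        iteratedDerivWithin i (covDerivIter P S c (n + 1 + 1)) S x₀ =
          ∑ l ∈ Finset.range (i + 1), i.choose l •
            iteratedDerivWithin l (fun x => P (c x)) S x₀
              (iteratedDerivWithin (i - l + 1) (covDerivIter P S c (n + 1)) S x₀) := by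
      intro c hc hcU
      have hX := contDiffOn_covDerivIter hP hS hc hcU (n + 1)
      have hf : ContDiffOn ℝ ∞ (fun x => P (c x)) S := hP.comp hc hcU
      have := iteratedDerivWithin_clm_apply (n := i) hS hx (hf.of_le (by exact_mod_cast le_top))
        ((hX.derivWithin (m := ∞) hS (by simp)).of_le (by exact_mod_cast le_top))
      simp only [← iteratedDerivWithin_succ'] at this
      exact this
    rw [hd c₁ hc₁ h₁, hd c₂ hc₂ h₂, ← Finset.sum_sub_distrib, Finset.sum_eq_single 0]
    · have h0 : c₁ x₀ = c₂ x₀ := by simpa using h 0 (by omega)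
      simp only [Nat.choose_zero_right, one_smul, iteratedDerivWithin_zero, Nat.sub_zero, ← h0]
      rw [← map_sub, ih (i + 1) (by omega)]
      have : (i + 1 + (n + 1) = j) ↔ (i + (n + 1 + 1) = j) := by omega
      simp only [this]
      split_ifs
      · rw [pow_succ']; rfl
      · simp
    -- For $l>0$ the derivatives of $P(c)$ agree for the two curves, since they involve orders below
    -- $j$ only; the vectors they act on agree as well, their total order being at most $j-l<j$.
    · intro l hl hl0
      have hl' : l ≤ i := by simpa [Nat.lt_succ_iff] using hl
      rw [← iteratedDerivWithin_comp_congr hS hx hU hP hc₁ hc₂ h₁ h₂ (q := l)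
        fun i' hi' => h i' (by omega), ← smul_sub, ← map_sub, ih (i - l + 1) (by omega),
        if_neg (by omega)]
      simp
    · simp

/-- Isolates the top coefficient, which enters affinely. It is the one coefficient whose first
$x$-derivative at the boundary need not vanish, so it must be kept apart from the even part. -/
theorem covDerivIter_timePoly_eq {P : E → E →L[ℝ] E} {U : Set E} (hU : IsOpen U)
    (hP : ContDiffOn ℝ ∞ P U) {j : ℕ} {V : Fin (j + 1 + 1) → E} (hV : V 0 ∈ U) :
    covDerivIter P univ (timePoly V) (j + 1) 0 =
      covDerivIter P univ (timePoly (Function.update V (Fin.last (j + 1)) 0)) (j + 1) 0 +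
        ((P (V 0)) ^ j) (V (Fin.last (j + 1))) := by
  set W := Function.update V (Fin.last (j + 1)) 0 with hW
  have hW0 : W 0 = V 0 := by
    rw [hW, Function.update_of_ne]
    simp [Fin.ext_iff]
  -- An open set of times around $0$ on which both polynomials stay where `P` is smooth.
  set S := timePoly V ⁻¹' U ∩ timePoly W ⁻¹' U with hSdef
  have hS : IsOpen S := (hU.preimage (contDiff_timePoly V).continuous).inter
    (hU.preimage (contDiff_timePoly W).continuous)
  have h0 : (0 : ℝ) ∈ S := by simp [hSdef, timePoly_zero, hW0, hV]
  have hd : ∀ (Y : Fin (j + 1 + 1) → E) (i : Fin (j + 1 + 1)),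
      iteratedDerivWithin i (timePoly Y) S 0 = Y i := fun Y i => by
    rw [iteratedDerivWithin_of_isOpen hS h0, iteratedDeriv_timePoly]
  have key := iteratedDerivWithin_covDerivIter_sub hU hP hS.uniqueDiffOn h0
    (contDiff_timePoly W).contDiffOn (contDiff_timePoly V).contDiffOn
    (fun t ht => ht.2) (fun t ht => ht.1) (j := j + 1) (fun i hi => by
      have hl : (⟨i, by omega⟩ : Fin (j + 1 + 1)) ≠ Fin.last (j + 1) := by
        simp [Fin.ext_iff]; omega
      have h1 := hd W ⟨i, by omega⟩
      rw [hW, Function.update_of_ne hl, ← hd V ⟨i, by omega⟩] at h1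
      exact h1) j 0 (by omega)
  have h1 := hd W (Fin.last (j + 1))
  have h2 := hd V (Fin.last (j + 1))
  simp only [Fin.val_last] at h1 h2
  rw [if_pos (by omega), h1, h2, timePoly_zero, hW0, iteratedDerivWithin_zero,
    iteratedDerivWithin_zero, ← covDerivIter_univ_eqOn hS _ _ h0,
    ← covDerivIter_univ_eqOn hS _ _ h0] at key
  rw [← sub_eq_iff_eq_add', key, hW]
  simp

end CovariantIterates

/-! ### Propagation of the leading odd derivative through the formal solution. -/

section FlowCoefficients

universe v

variable {E : Type v} [NormedAddCommGroup E] [InnerProductSpace ℝ E]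

/-- The operator `ε P(y) + J(y) P(y)` of the flow. -/
noncomputable def flowOp (P' J' : E → E →L[ℝ] E) (ε : ℝ) (y : E) : E →L[ℝ] E :=
  ε • P' y + (J' y).comp (P' y)

theorem contDiffOn_flowOp {P' J' : E → E →L[ℝ] E} {U : Set E} (hP : ContDiffOn ℝ ∞ P' U)
    (hJ : ContDiffOn ℝ ∞ J' U) (ε : ℝ) : ContDiffOn ℝ ∞ (flowOp P' J' ε) U :=
  (hP.const_smul ε).add (hJ.clm_comp hP)

/-- The coefficients of the formal solution. -/
noncomputable def flowCoeff (P' J' : E → E →L[ℝ] E) (ε : ℝ) (u₀ : ℝ → E) : ℕ → ℝ → E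
  | 0 => u₀
  | n + 1 => fun x => iteratedDeriv n (fun s => flowRHS P' J' ε (formalSolution P' J' ε u₀ n s x)
        (dx (dx (formalSolution P' J' ε u₀ n s)) x)) 0

theorem formalSolution_eq_timePoly (P' J' : E → E →L[ℝ] E) (ε : ℝ) (u₀ : ℝ → E) (n : ℕ) (t x : ℝ) :
    formalSolution P' J' ε u₀ n t x =
      timePoly (fun l : Fin (n + 1) => flowCoeff P' J' ε u₀ l x) t := by
  induction n with
  | zero => simp [formalSolution, timePoly, flowCoeff]
  | succ n ih =>
    simp only [formalSolution]
    rw [ih, timePoly, timePoly, Fin.sum_univ_castSucc (n := n + 1)]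
    rfl

theorem timeDeriv_eq_flowCoeff (P' J' : E → E →L[ℝ] E) (ε : ℝ) (u₀ : ℝ → E) (j : ℕ) :
    timeDeriv P' J' ε u₀ j = flowCoeff P' J' ε u₀ j := by
  funext x
  simp only [timeDeriv, formalSolution_eq_timePoly]
  exact iteratedDeriv_timePoly (fun l : Fin (j + 1) => flowCoeff P' J' ε u₀ l x) (Fin.last j)

theorem covTimeDeriv_eq (P' J' : E → E →L[ℝ] E) (ε : ℝ) (u₀ : ℝ → E) (j : ℕ) (x : ℝ) :
    covTimeDeriv P' J' ε u₀ j x = covDerivIter P' univ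
      (timePoly (fun l : Fin (j + 1) => flowCoeff P' J' ε u₀ l x)) j 0 := by
  simp only [covTimeDeriv, formalSolution_eq_timePoly]

theorem uniqueDiffOn_unitInterval : UniqueDiffOn ℝ (Icc (0 : ℝ) 1) :=
  uniqueDiffOn_Icc zero_lt_one

theorem dx_timePoly {j : ℕ} {V : Fin (j + 1) → ℝ → E}
    (hV : ∀ l, DifferentiableOn ℝ (V l) (Icc 0 1)) (t : ℝ) :
    EqOn (dx (fun x => timePoly (fun l => V l x) t)) (fun x => timePoly (fun l => dx (V l) x) t)
      (Icc 0 1) := by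
  intro x hx
  refine HasDerivWithinAt.derivWithin ?_ (uniqueDiffOn_unitInterval x hx)
  exact HasDerivWithinAt.fun_sum fun l _ => ((hV l x hx).hasDerivWithinAt.const_smul _)

/-- The Leibniz rule in $t$ for $A(u)\,\partial_x^2u$; since $u$ is a polynomial in $t$,
$\partial_x^2$ acts on its coefficients. -/
theorem flowCoeff_succ_eqOn {P' J' : E → E →L[ℝ] E} {U : Set E} (hU : IsOpen U)
    (hP : ContDiffOn ℝ ∞ P' U) (hJ : ContDiffOn ℝ ∞ J' U) {ε : ℝ} {u₀ : ℝ → E}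
    (hu : MapsTo u₀ (Icc 0 1) U) {j : ℕ}
    (hV : ∀ l ≤ j, ContDiffOn ℝ 2 (flowCoeff P' J' ε u₀ l) (Icc 0 1)) :
    EqOn (flowCoeff P' J' ε u₀ (j + 1)) (fun x => ∑ i ∈ Finset.range (j + 1), j.choose i •
      (iteratedDeriv i (fun t => flowOp P' J' ε (timePoly (fun l : Fin (j + 1) =>
        flowCoeff P' J' ε u₀ l x) t)) 0) (dx (dx (flowCoeff P' J' ε u₀ (j - i))) x))
      (Icc 0 1) := by
  intro x hx
  set V : Fin (j + 1) → E := fun l => flowCoeff P' J' ε u₀ l x with hVdef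
  set W : Fin (j + 1) → E := fun l => dx (dx (flowCoeff P' J' ε u₀ l)) x with hWdef
  set S := timePoly V ⁻¹' U with hSdef
  have hS : IsOpen S := hU.preimage (contDiff_timePoly V).continuous
  have h0 : (0 : ℝ) ∈ S := by
    simp only [hSdef, mem_preimage, timePoly_zero]
    exact hu hx
  have hdd : ∀ s, dx (dx (formalSolution P' J' ε u₀ j s)) x = timePoly W s := by
    intro s
    have h1 : formalSolution P' J' ε u₀ j s =
        fun x => timePoly (fun l : Fin (j + 1) => flowCoeff P' J' ε u₀ l x) s :=
      funext fun x => formalSolution_eq_timePoly P' J' ε u₀ j s x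
    have h2 := dx_timePoly (V := fun l : Fin (j + 1) => flowCoeff P' J' ε u₀ l)
      (fun l => (hV l (by omega)).differentiableOn (by simp)) s
    have h3 := dx_timePoly (V := fun l : Fin (j + 1) => dx (flowCoeff P' J' ε u₀ l))
      (fun l => ((hV l (by omega)).derivWithin (m := 1) uniqueDiffOn_unitInterval
        (by norm_num)).differentiableOn (by simp)) s
    rw [h1]
    exact (derivWithin_congr h2 (h2 hx)).trans (h3 hx)
  have hrhs : (fun s => flowRHS P' J' ε (formalSolution P' J' ε u₀ j s x)
      (dx (dx (formalSolution P' J' ε u₀ j s)) x)) =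
      fun s => flowOp P' J' ε (timePoly V s) (timePoly W s) := by
    funext s
    rw [hdd, formalSolution_eq_timePoly]
    rfl
  have hA : ContDiffOn ℝ ∞ (fun t => flowOp P' J' ε (timePoly V t)) S :=
    (contDiffOn_flowOp hP hJ ε).comp (contDiff_timePoly V).contDiffOn (mapsTo_preimage _ _)
  have hlhs : flowCoeff P' J' ε u₀ (j + 1) x =
      iteratedDeriv j (fun s => flowOp P' J' ε (timePoly V s) (timePoly W s)) 0 :=
    congrArg (fun f => iteratedDeriv j f 0) hrhs
  rw [hlhs, ← iteratedDerivWithin_of_isOpen hS h0,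
    iteratedDerivWithin_clm_apply hS.uniqueDiffOn h0
      (hA.of_le (by exact_mod_cast le_top))
      ((contDiff_timePoly W).contDiffOn.of_le (by exact_mod_cast le_top))]
  refine Finset.sum_congr rfl fun i _ => ?_
  have h4 := iteratedDeriv_timePoly W ⟨j - i, by omega⟩
  simp only at h4
  rw [iteratedDerivWithin_of_isOpen hS h0, iteratedDerivWithin_of_isOpen hS h0, h4]

/-- The top odd derivative of `u₀` at a boundary point propagates to the coefficients of the
formal solution through the operator of the flow. -/
theorem hasJet_flowCoeff {P' J' : E → E →L[ℝ] E} {U : Set E} (hU : IsOpen U)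
    (hP : ContDiffOn ℝ ∞ P' U) (hJ : ContDiffOn ℝ ∞ J' U) {ε : ℝ} {u₀ : ℝ → E}
    (hu : MapsTo u₀ (Icc 0 1) U) {x₀ : ℝ} (hx : x₀ ∈ Icc (0 : ℝ) 1) {m : ℕ} {r : E}
    (h : HasJet (Icc 0 1) x₀ (2 * m + 1) u₀ r) {j : ℕ} (hj : j ≤ m) :
    HasJet (Icc 0 1) x₀ (2 * (m - j) + 1) (flowCoeff P' J' ε u₀ j)
      ((flowOp P' J' ε (u₀ x₀) ^ j) r) := by
  induction j using Nat.strong_induction_on with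
  | _ j ih =>
    cases j with
    | zero => simpa [flowCoeff] using h
    | succ j =>
      have hS := uniqueDiffOn_unitInterval
      set A := flowOp P' J' ε with hA
      have hV : ∀ l ≤ j, HasJet (Icc 0 1) x₀ (2 * (m - l) + 1) (flowCoeff P' J' ε u₀ l)
          ((A (u₀ x₀) ^ l) r) := fun l hl => ih l (by omega) (by omega)
      have heq := flowCoeff_succ_eqOn hU hP hJ (ε := ε) hu (j := j)
        fun l hl => (hV l hl).1.of_le (by norm_cast; omega)
      have hq : 2 * (m - (j + 1)) + 1 < 2 * (m - j) + 1 := by omega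
      refine HasJet.congr hx ?_ heq
      have hvec : EvenTo (Icc 0 1) x₀ (2 * (m - (j + 1)) + 1)
          (fun x (l : Fin (j + 1)) => flowCoeff P' J' ε u₀ l x) :=
        EvenTo.pi hx hS fun l => (hV l (by omega)).evenTo (by simp) (by omega)
      -- Two $x$-derivatives bring $V_j$ exactly to the target order and keep its leading
      -- derivative. For $l<j$ an even surplus of $2(j-l)$ orders remains, so the derivative at the
      -- target order is a lower one and vanishes.
      have hW : ∀ l ≤ j, HasJet (Icc 0 1) x₀ (2 * (m - (j + 1)) + 1)
          (dx (dx (flowCoeff P' J' ε u₀ l))) (if l = j then (A (u₀ x₀) ^ j) r else 0) := by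
        intro l hl
        have h1 := hV l hl
        have h2 : 2 * (m - l) + 1 = 2 * (m - (l + 1)) + 1 + 1 + 1 := by omega
        rw [h2] at h1
        have h3 := (h1.derivWithin hS).derivWithin hS
        split_ifs with hlj
        · subst hlj; exact h3
        · exact h3.sub_two_mul (by omega) ⟨j - l, by omega⟩
      have hsum : (A (u₀ x₀) ^ (j + 1)) r = ∑ i ∈ Finset.range (j + 1), (j.choose i : ℝ) •
          (iteratedDeriv i (fun t => A (timePoly (fun l : Fin (j + 1) =>
            flowCoeff P' J' ε u₀ l x₀) t)) 0)
            (if j - i = j then (A (u₀ x₀) ^ j) r else 0) := by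
        rw [Finset.sum_eq_single 0]
        · simp [timePoly_zero, flowCoeff, pow_succ']
        · intro i hi hi0
          have : i < j + 1 := by simpa using hi
          rw [if_neg (by omega)]; simp
        · simp
      rw [hsum]
      simp only [← Nat.cast_smul_eq_nsmul ℝ]
      refine HasJet.sum hS hx _ fun i _ => HasJet.const_smul _ ?_
      refine HasJet.clm_apply hS hx ?_ (hW (j - i) (by omega))
      -- $\partial_t^iA(u)|_{t=0}$ is a smooth function of $V_0,\dots,V_j$, whose jets are even to
      -- this order; hence it is even.
      exact EvenTo.comp hS hx (f := fun x (l : Fin (j + 1)) => flowCoeff P' J' ε u₀ l x)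
        (g := fun V => iteratedDeriv i (fun t => A (timePoly V t)) 0)
        (U := {V | V 0 ∈ U}) (hU.preimage (continuous_apply 0))
        (contDiffOn_iteratedDeriv_comp_timePoly hU (contDiffOn_flowOp hP hJ ε) j i)
        (fun x hx => hu hx) hvec

theorem HasJet.derivWithin_eq {F : Type*} [NormedAddCommGroup F] [NormedSpace ℝ F] {S : Set ℝ}
    {x₀ : ℝ} {f : ℝ → F} {r : F} (h : HasJet S x₀ 1 f r) :
    _root_.derivWithin f S x₀ = r := by
  simpa [iteratedDerivWithin_one] using h.2.2

theorem dx_timeDeriv {P' J' : E → E →L[ℝ] E} {U : Set E} (hU : IsOpen U)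
    (hP : ContDiffOn ℝ ∞ P' U) (hJ : ContDiffOn ℝ ∞ J' U) {ε : ℝ} {u₀ : ℝ → E}
    (hu : MapsTo u₀ (Icc 0 1) U) {x₀ : ℝ} (hx : x₀ ∈ Icc (0 : ℝ) 1) {m : ℕ} {r : E}
    (h : HasJet (Icc 0 1) x₀ (2 * m + 1) u₀ r) :
    dx (timeDeriv P' J' ε u₀ m) x₀ = (flowOp P' J' ε (u₀ x₀) ^ m) r := by
  have h1 := hasJet_flowCoeff hU hP hJ (ε := ε) hu hx h le_rfl
  rw [Nat.sub_self, mul_zero, zero_add] at h1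
  rw [timeDeriv_eq_flowCoeff]
  exact h1.derivWithin_eq

/-- By `covDerivIter_timePoly_eq`, $\tilde V_m$ is a smooth function of even coefficients, with zero
$x$-derivative at $x_0$, plus $P^{m-1}V_m$. The exponent is $m-1$ because the first time derivative
carries no projection; truncated subtraction gives the right value at $m=0$. -/
theorem dx_covTimeDeriv {P' J' : E → E →L[ℝ] E} {U : Set E} (hU : IsOpen U)
    (hP : ContDiffOn ℝ ∞ P' U) (hJ : ContDiffOn ℝ ∞ J' U) {ε : ℝ} {u₀ : ℝ → E}
    (hu : MapsTo u₀ (Icc 0 1) U) {x₀ : ℝ} (hx : x₀ ∈ Icc (0 : ℝ) 1) {m : ℕ} {r : E}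
    (h : HasJet (Icc 0 1) x₀ (2 * m + 1) u₀ r) :
    dx (covTimeDeriv P' J' ε u₀ m) x₀ =
      ((P' (u₀ x₀)) ^ (m - 1)) ((flowOp P' J' ε (u₀ x₀) ^ m) r) := by
  have hS := uniqueDiffOn_unitInterval
  cases m with
  | zero => exact h.derivWithin_eq
  | succ j =>
    set V : ℕ → ℝ → E := flowCoeff P' J' ε u₀ with hVdef
    have hV : ∀ l ≤ j + 1, HasJet (Icc 0 1) x₀ (2 * (j + 1 - l) + 1) (V l)
        ((flowOp P' J' ε (u₀ x₀) ^ l) r) :=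
      fun l hl => hasJet_flowCoeff hU hP hJ (ε := ε) hu hx h hl
    have htop := hV (j + 1) le_rfl
    rw [Nat.sub_self, mul_zero, zero_add] at htop
    have heq : EqOn (covTimeDeriv P' J' ε u₀ (j + 1)) (fun x =>
        covDerivIter P' univ (timePoly (Function.update (fun l : Fin (j + 1 + 1) => V l x)
          (Fin.last (j + 1)) 0)) (j + 1) 0 + ((P' (u₀ x)) ^ j) (V (j + 1) x)) (Icc 0 1) := by
      intro x hxI
      rw [covTimeDeriv_eq]
      exact covDerivIter_timePoly_eq hU hP (V := fun l : Fin (j + 1 + 1) => V l x) (hu hxI)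
    have hvec : EvenTo (Icc 0 1) x₀ 1
        (fun x => Function.update (fun l : Fin (j + 1 + 1) => V l x) (Fin.last (j + 1)) 0) := by
      have := EvenTo.pi (S := Icc 0 1) (q := 1) hx hS
        (f := fun (l : Fin (j + 1 + 1)) x => if l = Fin.last (j + 1) then 0 else V l x) fun l => by
          split_ifs with hl
          · exact hasJet_zero.evenTo_self (by simp)
          · have : (l : ℕ) ≠ j + 1 := fun h => hl (Fin.ext h)
            exact (hV l (by omega)).evenTo (by simp) (by omega)
      convert this using 3 with x l
      simp [Function.update_apply]
    have hpow : ∀ n, ContDiffOn ℝ ∞ (fun y => P' y ^ n) U := by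
      intro n
      induction n with
      | zero => simpa using contDiffOn_const
      | succ n ih =>
        simp only [pow_succ]
        exact ih.clm_comp hP
    have h1 : HasJet (Icc 0 1) x₀ 1 (covTimeDeriv P' J' ε u₀ (j + 1))
        (0 + ((P' (u₀ x₀)) ^ j) ((flowOp P' J' ε (u₀ x₀) ^ (j + 1)) r)) := by
      refine HasJet.congr hx (HasJet.add hS hx (EvenTo.hasJet_zero ?_ (by simp))
        (HasJet.clm_apply hS hx ?_ htop)) heq
      · refine EvenTo.comp hS hx
          (g := fun V : Fin (j + 1 + 1) → E => covDerivIter P' univ (timePoly V) (j + 1) 0)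
          (U := {V | V 0 ∈ U}) (hU.preimage (continuous_apply 0))
          (contDiffOn_covDerivIter_timePoly hU hP (j + 1) (j + 1)) (fun x hxI => ?_) hvec
        rw [mem_ofPred_eq, Function.update_of_ne (by simp [Fin.ext_iff])]
        exact hu hxI
      · exact EvenTo.comp hS hx (g := fun y => P' y ^ j) hU (hpow j) hu
          (h.evenTo (p := 1) (by simp) (by omega))
    rw [zero_add] at h1
    exact h1.derivWithin_eq

/-- The top odd derivative of `u₀` propagates to the covariant derivatives of `u₀`. -/
theorem hasJet_covDerivIter {P : E → E →L[ℝ] E} {U : Set E} (hU : IsOpen U)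
    (hP : ContDiffOn ℝ ∞ P U) {S : Set ℝ} (hS : UniqueDiffOn ℝ S) {x₀ : ℝ} (hx : x₀ ∈ S)
    {u : ℝ → E} (hu : MapsTo u S U) {q : ℕ} (hq : Odd q) {r : E} (h : HasJet S x₀ q u r)
    (hr : P (u x₀) r = r) (n : ℕ) (hn : n + 1 ≤ q) :
    HasJet S x₀ (q - (n + 1)) (covDerivIter P S u (n + 1)) r := by
  induction n with
  | zero =>
    obtain ⟨q, rfl⟩ : ∃ p, q = p + 1 := ⟨q - 1, by omega⟩
    exact h.derivWithin hS
  | succ n ih =>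
    have h1 := ih (by omega)
    have h2 : q - (n + 1) = q - (n + 1 + 1) + 1 := by omega
    rw [h2] at h1
    have h3 := HasJet.clm_apply hS hx (EvenTo.comp hS hx hU hP hu (h.evenTo hq (by omega)))
      (h1.derivWithin hS)
    rw [hr] at h3
    exact h3

end FlowCoefficients

/-! ### Tangent vectors, retractions and smooth extensions off the submanifold. -/

section Geometry

open scoped Manifold Topology

variable {E : Type*} [NormedAddCommGroup E] [InnerProductSpace ℝ E]

theorem fderiv_symm_mem_tangentSpace {N : Set E} {p : E} (hp : p ∈ N)
    {e : OpenPartialHomeomorph E E} {F : Submodule ℝ E} (hpe : p ∈ e.source)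
    (he : ContDiffOn ℝ ∞ e.symm e.target) (hF : ∀ y ∈ e.source, (e y ∈ F ↔ y ∈ N))
    {v : E} (hv : v ∈ F) : fderiv ℝ e.symm (e p) v ∈ tangentSpace N p := by
  obtain ⟨δ, hδ, hball⟩ := Metric.isOpen_iff.1 e.open_target (e p) (e.map_source hpe)
  set a : ℝ := δ / (‖v‖ + 1) with ha
  have hva : 0 < ‖v‖ + 1 := by positivity
  have ha0 : 0 < a := by positivity
  -- A curve defining a tangent vector must stay in $N$ for all times. This parameter has unit speed
  -- at $0$ and modulus at most $a$, and $a\|v\|<\delta$ keeps the segment inside the chart.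
  set w : ℝ → ℝ := fun t => a * Real.sin (t / a) with hw
  have hwc : ContDiff ℝ ∞ w := by
    simp only [hw]
    fun_prop
  have hw0 : w 0 = 0 := by simp [hw]
  have hwd : HasDerivAt w 1 0 := by
    have h := ((hasDerivAt_id (0 : ℝ)).div_const a).sin.const_mul a
    simpa [ha0.ne'] using h
  have hmem : ∀ t, e p + w t • v ∈ e.target := by
    intro t
    apply hball
    rw [Metric.mem_ball, dist_eq_norm, add_sub_cancel_left, norm_smul, Real.norm_eq_abs, abs_mul,
      abs_of_pos ha0]
    calc a * |Real.sin (t / a)| * ‖v‖ ≤ a * 1 * ‖v‖ := by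
          gcongr; exact Real.abs_sin_le_one _
      _ < a * (‖v‖ + 1) := by nlinarith
      _ = δ := by rw [ha]; field_simp
  refine Submodule.subset_span ⟨fun t => e.symm (e p + w t • v), ?_, fun t => ?_, ?_, ?_⟩
  · have h1 : ContDiff ℝ ∞ (fun t => e p + w t • v) := by fun_prop
    exact contDiffOn_univ.1 (he.comp h1.contDiffOn fun t _ => hmem t)
  · rw [← hF _ (e.map_target (hmem t)), e.right_inv (hmem t)]
    exact F.add_mem ((hF p hpe).2 hp) (F.smul_mem _ hv)
  · simp [hw0, e.left_inv hpe]
  · have h1 : HasDerivAt (fun t => e p + w t • v) v 0 := by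
      simpa using (hwd.smul_const v).const_add (e p)
    have h2 : HasFDerivAt e.symm (fderiv ℝ e.symm (e p)) (e p + w 0 • v) := by
      simpa [hw0] using ((he.contDiffAt (e.open_target.mem_nhds
        (e.map_source hpe))).differentiableAt (by simp)).hasFDerivAt
    exact (h2.comp_hasDerivAt (0 : ℝ) h1).deriv

/-- The one-sided velocity of a curve in `N` is tangent to `N`. -/
theorem derivWithin_mem_tangentSpace [FiniteDimensional ℝ E] {N : Set E}
    (hN : IsEmbeddedSubmanifold N) {c : ℝ → E}
    {S : Set ℝ} (hS : UniqueDiffOn ℝ S) (hc : MapsTo c S N) {x : ℝ} (hx : x ∈ S)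
    (hcd : DifferentiableWithinAt ℝ c S x) : derivWithin c S x ∈ tangentSpace N (c x) := by
  obtain ⟨d, hd⟩ := hN
  obtain ⟨e, F, hpe, he, hes, -, hF⟩ := hd (c x) (hc hx)
  have h1 : HasFDerivAt e (fderiv ℝ e (c x)) (c x) :=
    ((he.contDiffAt (e.open_source.mem_nhds hpe)).differentiableAt (by simp)).hasFDerivAt
  have h2 : HasFDerivAt e.symm (fderiv ℝ e.symm (e (c x))) (e (c x)) :=
    ((hes.contDiffAt (e.open_target.mem_nhds (e.map_source hpe))).differentiableAt
      (by simp)).hasFDerivAt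
  have h3 := h1.comp_hasDerivWithinAt x hcd.hasDerivWithinAt
  have hnhds : ∀ᶠ y in 𝓝[S] x, c y ∈ e.source :=
    hcd.continuousWithinAt.preimage_mem_nhdsWithin (e.open_source.mem_nhds hpe)
  have hmem : fderiv ℝ e (c x) (derivWithin c S x) ∈ F := by
    -- In the chart the difference quotients lie in the closed subspace `F`, hence so does their
    -- limit.
    have hlim := hasDerivWithinAt_iff_tendsto_slope.1 h3
    have := accPt_principal_iff_nhdsWithin.1 (uniqueDiffWithinAt_iff_accPt.1 (hS x hx))
    refine (Submodule.closed_of_finiteDimensional F).mem_of_frequently_of_tendsto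
      (Filter.Eventually.frequently (f := 𝓝[S \ {x}] x) ?_) hlim
    have h4 : ∀ᶠ y in 𝓝[S \ {x}] x, c y ∈ e.source :=
      hnhds.filter_mono (nhdsWithin_mono _ sdiff_subset)
    filter_upwards [h4, self_mem_nhdsWithin] with y hy hyS
    exact F.smul_mem _ (F.sub_mem ((hF _ hy).2 (hc hyS.1)) ((hF _ hpe).2 (hc hx)))
  have h5 : HasDerivWithinAt c
      (fderiv ℝ e.symm (e (c x)) (fderiv ℝ e (c x) (derivWithin c S x))) S x := by
    refine (h2.comp_hasDerivWithinAt x h3).congr_of_eventuallyEq ?_ (by simp [e.left_inv hpe])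
    filter_upwards [hnhds] with y hy
    simp [e.left_inv hy]
  rw [h5.derivWithin (hS x hx)]
  exact fderiv_symm_mem_tangentSpace (hc hx) hpe hes hF hmem

/-- Flatten $N$ by a chart, project orthogonally onto the model subspace and return; the
neighbourhood consists of the points whose projection is still in the chart's target. -/
theorem exists_local_retraction [FiniteDimensional ℝ E] {N : Set E} (hN : IsEmbeddedSubmanifold N)
    {p : E} (hp : p ∈ N) : ∃ (W : Set E) (ρ : E → E), IsOpen W ∧ p ∈ W ∧ ContDiffOn ℝ ∞ ρ W ∧
      MapsTo ρ W N ∧ ∀ y ∈ W, y ∈ N → ρ y = y := by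
  obtain ⟨d, hd⟩ := hN
  obtain ⟨e, F, hpe, he, hes, -, hF⟩ := hd p hp
  have hfix : ∀ y ∈ e.source, y ∈ N → F.starProjection (e y) = e y := fun y hy hyN =>
    Submodule.starProjection_eq_self_iff.2 ((hF y hy).2 hyN)
  refine ⟨e.source ∩ e ⁻¹' (F.starProjection ⁻¹' e.target),
    fun y => e.symm (F.starProjection (e y)),
    e.isOpen_inter_preimage (e.open_target.preimage F.starProjection.continuous),
    ⟨hpe, ?_⟩, ?_, fun y hy => ?_, fun y hy hyN => ?_⟩
  · rw [mem_preimage, mem_preimage, hfix p hpe hp]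
    exact e.map_source hpe
  · exact hes.comp (F.starProjection.contDiff.comp_contDiffOn (he.mono inter_subset_left))
      fun y hy => hy.2
  · rw [← hF _ (e.map_target hy.2), e.right_inv hy.2]
    exact F.starProjection_apply_mem _
  · simp only
    rw [hfix y hy.1 hyN, e.left_inv hy.1]

/-- A smooth map on an embedded submanifold extends smoothly to a neighbourhood. -/
theorem exists_contDiffOn_extension [FiniteDimensional ℝ E] {G : Type*} [NormedAddCommGroup G]
    [NormedSpace ℝ G] {N : Set E} (hN : IsEmbeddedSubmanifold N) {f : E → G}
    (hf : ContDiffOn ℝ ∞ f N) :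
    ∃ (U : Set E) (g : E → G), IsOpen U ∧ N ⊆ U ∧ ContDiffOn ℝ ∞ g U ∧ EqOn g f N := by
  choose W ρ hWo hpW hρ hρN hρfix using fun p : N => exists_local_retraction hN p.2
  let U : TopologicalSpace.Opens E := ⟨⋃ p, W p, isOpen_iUnion hWo⟩
  have hNU : N ⊆ U := fun p hp => mem_iUnion.2 ⟨⟨p, hp⟩, hpW ⟨p, hp⟩⟩
  have : LocallyCompactSpace U := U.isOpen.locallyCompactSpace
  -- Locally $f\circ\rho_p$ extends $f$. Having the prescribed value on $N$ is a convex condition,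
  -- so a partition of unity on the open manifold `U` glues these extensions.
  obtain ⟨g, hg⟩ := exists_contMDiffMap_forall_mem_convex_of_local (M := U) (F := G) (n := (⊤ : ℕ∞))
    𝓘(ℝ, E) (t := fun y => {v | (y : E) ∈ N → v = f y}) (fun y => by
      by_cases hy : (y : E) ∈ N
      · simp [hy]
      · simp [hy, convex_univ]) (fun x => by
      obtain ⟨p, hp⟩ := mem_iUnion.1 x.2
      refine ⟨Subtype.val ⁻¹' W p,
        ((hWo p).preimage continuous_subtype_val).mem_nhds hp, fun y => f (ρ p y), ?_, ?_⟩
      · have h1 : ContDiffOn ℝ ∞ (fun y => f (ρ p y)) (W p) := hf.comp (hρ p) (hρN p)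
        exact h1.contMDiffOn.comp (contMDiff_subtype_val (U := U)).contMDiffOn
          (mapsTo_preimage _ _)
      · intro y hy hyN
        exact congrArg f (hρfix p y hy hyN))
  classical
  let g' : E → G := fun y => if h : y ∈ U then g ⟨y, h⟩ else 0
  have hg' : (fun y : U => g' y) = g := by
    funext y
    simp [g', y.2]
  refine ⟨U, g', U.isOpen, hNU, fun y hy => ?_, fun y hy => ?_⟩
  · have h1 : ContMDiffAt 𝓘(ℝ, E) 𝓘(ℝ, G) ∞ (fun y : U => g' y) ⟨y, hy⟩ := by
      rw [hg']; exact g.contMDiff _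
    exact (contMDiffAt_subtype_iff.1 h1).contDiffAt.contDiffWithinAt
  · have h1 := hg ⟨y, hNU hy⟩ hy
    simpa [g', show y ∈ U from hNU hy] using h1

/-- On $N$ one has $(JP)(JP)=J^2P=-P$, so an extension `g` of the smooth field $JP$ also provides
one of $P$, namely $-g^2$. Existence ensures that the quantifier over extensions in `Compatible` and
`CovCompatible` is not vacuous. -/
theorem exists_isSmoothExtension [FiniteDimensional ℝ E] {N : Set E} {J : E → E →L[ℝ] E}
    (hN : IsKahlerSubmanifold N J) : ∃ P' J', IsSmoothExtension N J P' J' := by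
  obtain ⟨U, g, hU, hNU, hg, hgf⟩ := exists_contDiffOn_extension hN.submanifold hN.smooth
  refine ⟨fun y => -((g y).comp (g y)), g, ⟨U, hU, hNU, (hg.clm_comp hg).neg, hg⟩,
    fun p hp => ?_, fun p hp v hv => ?_⟩
  · ext v
    have h1 : tangentProj N p v ∈ tangentSpace N p := Submodule.starProjection_apply_mem _ _
    have h2 := hN.mapsTo p hp _ h1
    have h3 : tangentProj N p (J p (tangentProj N p v)) = J p (tangentProj N p v) :=
      Submodule.starProjection_eq_self_iff.2 h2
    simp [hgf hp, h3, hN.sq_eq_neg p hp _ h1]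
  · have h3 : tangentProj N p v = v := Submodule.starProjection_eq_self_iff.2 hv
    simp [hgf hp, h3]

end Geometry

/-! ### The Sobolev embedding on the unit interval. -/

section Sobolev

open scoped Topology

/-- A smooth function with compact support in `(0,1)`. -/
structure IsTestFunction (η : ℝ → ℝ) : Prop where
  contDiff : ContDiff ℝ ∞ η
  hasCompactSupport : HasCompactSupport η
  tsupport_subset : tsupport η ⊆ Ioo 0 1

theorem IsTestFunction.eq_zero {η : ℝ → ℝ} (h : IsTestFunction η) {x : ℝ} (hx : x ∉ Ioo (0 : ℝ) 1) :
    η x = 0 :=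
  image_eq_zero_of_notMem_tsupport fun hx' => hx (h.tsupport_subset hx')

theorem IsTestFunction.deriv {η : ℝ → ℝ} (h : IsTestFunction η) : IsTestFunction (deriv η) :=
  ⟨(contDiff_infty_iff_deriv.1 h.contDiff).2, h.hasCompactSupport.deriv,
    (tsupport_deriv_subset).trans h.tsupport_subset⟩

theorem exists_isTestFunction_integral_eq_one : ∃ ψ, IsTestFunction ψ ∧ ∫ x, ψ x = 1 := by
  let b : ContDiffBump (1 / 2 : ℝ) := ⟨1 / 8, 1 / 4, by norm_num, by norm_num⟩
  refine ⟨b.normed volume, ⟨b.contDiff_normed, b.hasCompactSupport_normed, ?_⟩,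
    b.integral_normed⟩
  rw [b.tsupport_normed_eq, Real.closedBall_eq_Icc]
  exact Icc_subset_Ioo (by simp [b]; norm_num) (by simp [b]; norm_num)

/-- A test function with vanishing integral is the derivative of a test function. -/
theorem IsTestFunction.exists_deriv_eq {θ : ℝ → ℝ} (h : IsTestFunction θ) (h0 : ∫ x, θ x = 0) :
    ∃ η, IsTestFunction η ∧ _root_.deriv η = θ := by
  have hc : Continuous θ := h.contDiff.continuous
  have hd : ∀ x, HasDerivAt (fun x => ∫ y in (0 : ℝ)..x, θ y) (θ x) x := fun x =>
    intervalIntegral.integral_hasDerivAt_right (hc.intervalIntegrable _ _)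
      (hc.stronglyMeasurableAtFilter _ _) hc.continuousAt
  have hderiv : _root_.deriv (fun x => ∫ y in (0 : ℝ)..x, θ y) = θ := funext fun x => (hd x).deriv
  obtain ⟨a, b, ha, hb, hab⟩ : ∃ a b : ℝ, 0 < a ∧ b < 1 ∧ tsupport θ ⊆ Icc a b := by
    rcases (tsupport θ).eq_empty_or_nonempty with he | hne
    · exact ⟨1 / 2, 1 / 2, by norm_num, by norm_num, by simp [he]⟩
    · obtain ⟨a, ha⟩ := h.hasCompactSupport.isCompact.exists_isLeast hne
      obtain ⟨b, hb⟩ := h.hasCompactSupport.isCompact.exists_isGreatest hne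
      exact ⟨a, b, (h.tsupport_subset ha.1).1, (h.tsupport_subset hb.1).2,
        fun x hx => ⟨ha.2 hx, hb.2 hx⟩⟩
  have hz : ∀ x ∉ Icc a b, θ x = 0 := fun x hx =>
    image_eq_zero_of_notMem_tsupport fun hx' => hx (hab hx')
  have hsupp : Function.support (fun x => ∫ y in (0 : ℝ)..x, θ y) ⊆ Icc a b := by
    intro x hx
    by_contra hxab
    apply hx
    beta_reduce
    -- To the left of the support the primitive is $0$; to the right it is the total integral, which
    -- vanishes by `h0`.
    simp only [mem_Icc, not_and_or, not_le] at hxab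
    rcases hxab with hxa | hbx
    · rw [intervalIntegral.integral_congr (g := fun _ => (0 : ℝ)), intervalIntegral.integral_zero]
      intro y hy
      refine hz y fun hy' => ?_
      rcases le_total 0 x with h0x | h0x
      · rw [uIcc_of_le h0x] at hy; linarith [hy.2, hy'.1]
      · rw [uIcc_of_ge h0x] at hy; linarith [hy.2, hy'.1]
    · by_cases hab' : a ≤ b
      · have h0x : 0 ≤ x := by linarith
        rw [intervalIntegral.integral_of_le h0x,
          setIntegral_eq_integral_of_forall_compl_eq_zero, h0]
        intro y hy
        refine hz y fun hy' => hy ⟨by linarith [hy'.1], by linarith [hy'.2]⟩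
      · have : θ = fun _ => 0 := funext fun y => hz y (by simp [hab'])
        simp [this]
  have htsupp : tsupport (fun x => ∫ y in (0 : ℝ)..x, θ y) ⊆ Icc a b :=
    closure_minimal hsupp isClosed_Icc
  refine ⟨_, ⟨?_, ?_, ?_⟩, hderiv⟩
  · exact contDiff_infty_iff_deriv.2 ⟨fun x => (hd x).differentiableAt, by
      rw [hderiv]; exact h.contDiff⟩
  · exact HasCompactSupport.of_support_subset_isCompact isCompact_Icc hsupp
  · exact htsupp.trans (Icc_subset_Ioo ha hb)

variable {E : Type*} [NormedAddCommGroup E] [NormedSpace ℝ E]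

theorem IsTestFunction.integrableOn_smul {η : ℝ → ℝ} (h : IsTestFunction η) {f : ℝ → E}
    (hf : IntegrableOn f (Ioo 0 1)) : IntegrableOn (fun x => η x • f x) (Ioo 0 1) := by
  obtain ⟨C, hC⟩ := h.hasCompactSupport.exists_bound_of_continuous h.contDiff.continuous
  exact Integrable.bdd_smul hf C h.contDiff.continuous.aestronglyMeasurable
    (Filter.Eventually.of_forall hC)

theorem IsTestFunction.setIntegral_smul {η : ℝ → ℝ} (h : IsTestFunction η) (f : ℝ → E) :
    ∫ x in Ioo (0 : ℝ) 1, η x • f x = ∫ x, η x • f x :=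
  setIntegral_eq_integral_of_forall_compl_eq_zero fun x hx => by rw [h.eq_zero hx, zero_smul]

theorem ae_eq_of_forall_isTestFunction [CompleteSpace E] {f g : ℝ → E}
    (hf : IntegrableOn f (Ioo 0 1)) (hg : IntegrableOn g (Ioo 0 1))
    (h : ∀ η, IsTestFunction η →
      ∫ x in Ioo (0 : ℝ) 1, η x • f x = ∫ x in Ioo (0 : ℝ) 1, η x • g x) :
    f =ᵐ[volume.restrict (Ioo 0 1)] g := by
  have hfg : IntegrableOn (f - g) (Ioo 0 1) := hf.sub hg
  have := isOpen_Ioo.ae_eq_zero_of_integral_contDiff_smul_eq_zero (μ := volume)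
    (f := f - g) hfg.locallyIntegrableOn fun η h1 h2 h3 => by
      have hη : IsTestFunction η := ⟨h1, h2, h3⟩
      rw [← hη.setIntegral_smul]
      simp only [Pi.sub_apply, smul_sub]
      rw [integral_sub (hη.integrableOn_smul hf) (hη.integrableOn_smul hg), h η hη, sub_self]
  rw [Filter.EventuallyEq, ae_restrict_iff' measurableSet_Ioo]
  filter_upwards [this] with x hx hxI
  exact sub_eq_zero.1 (hx hxI)

/-- The lemma of du Bois-Reymond. -/
theorem exists_ae_eq_const_of_integral_deriv_smul_eq_zero [CompleteSpace E] {w : ℝ → E}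
    (hw : IntegrableOn w (Ioo 0 1))
    (h : ∀ η, IsTestFunction η → ∫ x in Ioo (0 : ℝ) 1, deriv η x • w x = 0) :
    ∃ c : E, w =ᵐ[volume.restrict (Ioo 0 1)] fun _ => c := by
  obtain ⟨ψ, hψ, hψ1⟩ := exists_isTestFunction_integral_eq_one
  refine ⟨∫ x in Ioo (0 : ℝ) 1, ψ x • w x, ae_eq_of_forall_isTestFunction hw
    (integrableOn_const (by simp)) fun g hg => ?_⟩
  set c := ∫ x, g x with hc
  have hgi :=
    hg.contDiff.continuous.integrable_of_hasCompactSupport hg.hasCompactSupport (μ := volume)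
  have hψi :=
    hψ.contDiff.continuous.integrable_of_hasCompactSupport hψ.hasCompactSupport (μ := volume)
  -- Subtracting $c\psi$ makes the integral zero, so the result is the derivative of a test function
  -- and may be used in `h`.
  have hθ : IsTestFunction (fun x => g x - c * ψ x) :=
    ⟨hg.contDiff.sub (contDiff_const.mul hψ.contDiff),
      hg.hasCompactSupport.sub hψ.hasCompactSupport.mul_left,
      (tsupport_sub _ _).trans (union_subset hg.tsupport_subset
        ((tsupport_mul_subset_right).trans hψ.tsupport_subset))⟩
  obtain ⟨η, hη, hηθ⟩ := hθ.exists_deriv_eq (by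
    rw [integral_sub hgi (hψi.const_mul c), integral_const_mul, hψ1, mul_one, sub_self])
  have h1 := h η hη
  rw [hηθ] at h1
  simp only [sub_smul, mul_smul] at h1
  rw [integral_sub (hg.integrableOn_smul hw) ((hψ.integrableOn_smul hw).fun_smul c), integral_smul,
    sub_eq_zero] at h1
  rw [h1, integral_smul_const, hc,
    setIntegral_eq_integral_of_forall_compl_eq_zero fun x hx => hg.eq_zero hx]

/-- `g` is the weak derivative of `f` on `(0,1)`. -/
def HasWeakDeriv (f g : ℝ → E) : Prop :=
  ∀ η, IsTestFunction η →
    ∫ x in Ioo (0 : ℝ) 1, deriv η x • f x = -∫ x in Ioo (0 : ℝ) 1, η x • g x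

/-- Fubini on the triangle $s<x$, together with $\int_s^1\eta'=-\eta(s)$. -/
theorem hasWeakDeriv_primitive [CompleteSpace E] {g : ℝ → E} (hg : IntegrableOn g (Ioo 0 1)) :
    HasWeakDeriv (fun x => ∫ s in (0 : ℝ)..x, g s) g := by
  intro η hη
  set μ := volume.restrict (Ioo (0 : ℝ) 1) with hμ
  have hprim : ∀ x ∈ Ioo (0 : ℝ) 1, ∫ s in (0 : ℝ)..x, g s = ∫ s, (Iio x).indicator g s ∂μ := by
    intro x hx
    rw [integral_indicator measurableSet_Iio, hμ, Measure.restrict_restrict measurableSet_Iio,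
      intervalIntegral.integral_of_le hx.1.le, integral_Ioc_eq_integral_Ioo]
    congr 2
    ext s
    simp only [mem_Ioo, mem_inter_iff, mem_Iio]
    exact ⟨fun h => ⟨h.2, h.1, h.2.trans hx.2⟩, fun h => ⟨h.2.1, h.1⟩⟩
  have hη'i : Integrable (deriv η) μ :=
    (hη.deriv.contDiff.continuous.integrable_of_hasCompactSupport
      hη.deriv.hasCompactSupport).integrableOn
  have hint : Integrable (fun p : ℝ × ℝ => {p : ℝ × ℝ | p.2 < p.1}.indicator
      (fun p => deriv η p.1 • g p.2) p) (μ.prod μ) :=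
    (Integrable.smul_prod hη'i hg).indicator (measurableSet_lt measurable_snd measurable_fst)
  calc ∫ x in Ioo (0 : ℝ) 1, deriv η x • ∫ s in (0 : ℝ)..x, g s
      = ∫ x, ∫ s, {p : ℝ × ℝ | p.2 < p.1}.indicator (fun p => deriv η p.1 • g p.2) (x, s) ∂μ ∂μ := by
        refine setIntegral_congr_fun measurableSet_Ioo fun x hx => ?_
        rw [hprim x hx, ← integral_smul]
        congr 1
        funext s
        by_cases hs : s < x <;> simp [indicator, hs]
    _ = ∫ s, ∫ x, {p : ℝ × ℝ | p.2 < p.1}.indicator (fun p => deriv η p.1 • g p.2) (x, s) ∂μ ∂μ :=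
        integral_integral_swap hint
    _ = ∫ s in Ioo (0 : ℝ) 1, -(η s • g s) := by
        refine setIntegral_congr_fun measurableSet_Ioo fun s hs => ?_
        have h1 : (fun x => {p : ℝ × ℝ | p.2 < p.1}.indicator
            (fun p => deriv η p.1 • g p.2) (x, s)) =
            fun x => (Ioi s).indicator (deriv η) x • g s := by
          funext x
          by_cases hs : s < x <;> simp [indicator, hs]
        have h2 : Ioi s ∩ Ioo 0 1 = Ioo s 1 := by
          ext x
          simp only [mem_Ioo, mem_inter_iff, mem_Ioi]
          exact ⟨fun h => ⟨h.1, h.2.2⟩, fun h => ⟨h.1, hs.1.trans h.1, h.2⟩⟩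
        rw [h1, integral_smul_const, integral_indicator measurableSet_Ioi, hμ,
          Measure.restrict_restrict measurableSet_Ioi, h2, ← integral_Ioc_eq_integral_Ioo,
          ← intervalIntegral.integral_of_le hs.2.le,
          intervalIntegral.integral_deriv_eq_sub
            (fun x _ => (hη.contDiff.differentiable (by simp)) x)
            (hη.deriv.contDiff.continuous.intervalIntegrable _ _),
          hη.eq_zero (x := 1) (by simp), zero_sub, neg_smul]
    _ = -∫ x in Ioo (0 : ℝ) 1, η x • g x := integral_neg _

theorem continuousOn_primitive_unitInterval {g : ℝ → E} (hg : IntegrableOn g (Ioo 0 1)) :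
    ContinuousOn (fun x => ∫ s in (0 : ℝ)..x, g s) (Icc 0 1) := by
  have := intervalIntegral.continuousOn_primitive_interval (μ := volume) (f := g) (a := 0) (b := 1)
    (by rw [uIcc_of_le zero_le_one]; exact (integrableOn_Icc_iff_integrableOn_Ioo).2 hg)
  rwa [uIcc_of_le zero_le_one] at this

/-- A function with an integrable weak derivative agrees almost everywhere with a primitive. -/
theorem HasWeakDeriv.exists_ae_eq_primitive [CompleteSpace E] {f g : ℝ → E} (h : HasWeakDeriv f g)
    (hf : IntegrableOn f (Ioo 0 1)) (hg : IntegrableOn g (Ioo 0 1)) :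
    ∃ c : E, f =ᵐ[volume.restrict (Ioo 0 1)] fun x => c + ∫ s in (0 : ℝ)..x, g s := by
  have hG : IntegrableOn (fun x => ∫ s in (0 : ℝ)..x, g s) (Ioo 0 1) :=
    (continuousOn_primitive_unitInterval hg).integrableOn_Icc.mono_set Ioo_subset_Icc_self
  obtain ⟨c, hc⟩ := exists_ae_eq_const_of_integral_deriv_smul_eq_zero (hf.sub hG) fun η hη => by
    simp only [Pi.sub_apply, smul_sub]
    rw [integral_sub (hη.deriv.integrableOn_smul hf) (hη.deriv.integrableOn_smul hG), h η hη,
      hasWeakDeriv_primitive hg η hη, sub_self]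
  refine ⟨c, ?_⟩
  filter_upwards [hc] with x hx
  rw [← hx]
  simp

theorem HasWeakDeriv.congr_right {f g g' : ℝ → E} (h : HasWeakDeriv f g)
    (hg : g =ᵐ[volume.restrict (Ioo 0 1)] g') : HasWeakDeriv f g' := fun η hη => by
  rw [h η hη]
  congr 1
  exact integral_congr_ae (by filter_upwards [hg] with x hx; rw [hx])

theorem HasWeakDeriv.exists_ae_eq_contDiffOn_succ [CompleteSpace E] {f g : ℝ → E} {n : ℕ}
    (h : HasWeakDeriv f g) (hf : IntegrableOn f (Ioo 0 1)) (hg : ContDiffOn ℝ n g (Icc 0 1)) :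
    ∃ F : ℝ → E, ContDiffOn ℝ (n + 1 : ℕ) F (Icc 0 1) ∧ f =ᵐ[volume.restrict (Ioo 0 1)] F := by
  have hgi : IntegrableOn g (Ioo 0 1) :=
    hg.continuousOn.integrableOn_Icc.mono_set Ioo_subset_Icc_self
  obtain ⟨c, hc⟩ := h.exists_ae_eq_primitive hf hgi
  have hI := uniqueDiffOn_Icc (zero_lt_one (α := ℝ))
  have hd : ∀ x ∈ Icc (0 : ℝ) 1,
      HasDerivWithinAt (fun x => c + ∫ s in (0 : ℝ)..x, g s) (g x) (Icc 0 1) x := by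
    intro x hx
    -- The constant continuation of $g$ beyond the endpoints is continuous on $\mathbb R$, so the
    -- fundamental theorem of calculus also applies at $0$ and $1$.
    set gt : ℝ → E := IccExtend (zero_le_one (α := ℝ)) ((Icc 0 1).domRestrict g) with hgt
    have hgtc : Continuous gt := hg.continuousOn.domRestrict.Icc_extend'
    have heq : EqOn gt g (Icc 0 1) := fun y hy => IccExtend_of_mem _ _ hy
    have h1 : HasDerivAt (fun x => c + ∫ s in (0 : ℝ)..x, gt s) (gt x) x :=
      (intervalIntegral.integral_hasDerivAt_right (hgtc.intervalIntegrable _ _)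
        (hgtc.stronglyMeasurableAtFilter _ _) hgtc.continuousAt).const_add c
    rw [← heq hx]
    have h2 : EqOn (fun x => c + ∫ s in (0 : ℝ)..x, g s) (fun x => c + ∫ s in (0 : ℝ)..x, gt s)
        (Icc 0 1) := by
      intro y hy
      simp only
      congr 1
      refine intervalIntegral.integral_congr fun s hs => ?_
      rw [uIcc_of_le hy.1] at hs
      exact (heq ⟨hs.1, hs.2.trans hy.2⟩).symm
    exact h1.hasDerivWithinAt.congr h2 (h2 hx)
  refine ⟨_, ?_, hc⟩
  push_cast
  rw [contDiffOn_succ_iff_derivWithin hI]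
  exact ⟨fun x hx => (hd x hx).differentiableWithinAt, by simp,
    hg.congr fun x hx => (hd x hx).derivWithin (hI x hx)⟩

/-- The Sobolev embedding `H^{m+1}(0,1) ⊆ C^m([0,1])`, for the continuous representative. -/
theorem MemSobolev.contDiffOn {E : Type*} [NormedAddCommGroup E] [InnerProductSpace ℝ E]
    [CompleteSpace E] {m : ℕ} {u : ℝ → E}
    (h : MemSobolev (m + 1) u) (hu : ContinuousOn u (Icc 0 1)) : ContDiffOn ℝ m u (Icc 0 1) := by
  obtain ⟨-, h⟩ := h
  choose! g hg2 hg using h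
  have hgi : ∀ j ≤ m + 1, IntegrableOn (g j) (Ioo 0 1) := fun j hj =>
    (hg2 j hj).integrable (by norm_num)
  have hui : IntegrableOn u (Ioo 0 1) := hu.integrableOn_Icc.mono_set Ioo_subset_Icc_self
  have hiter : ∀ η, IsTestFunction η → ∀ j, IsTestFunction (iteratedDeriv j η) := by
    intro η hη j
    induction j with
    | zero => simpa using hη
    | succ j ih => rw [iteratedDeriv_succ]; exact ih.deriv
  -- Compare the defining identity of order $j+1$ for $\eta$ with that of order $j$ for $\eta'$.
  have hweak : ∀ j ≤ m, HasWeakDeriv (g j) (g (j + 1)) := by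
    intro j hj η hη
    have h1 := hg (j + 1) (by omega) η hη.contDiff hη.hasCompactSupport hη.tsupport_subset
    have hd := hη.deriv
    have h2 := hg j (by omega) (deriv η) hd.contDiff hd.hasCompactSupport hd.tsupport_subset
    rw [← iteratedDeriv_succ', h1, pow_succ, mul_neg_one, neg_smul] at h2
    have h3 : ((-1 : ℝ) ^ j) • (∫ x in Ioo (0 : ℝ) 1, deriv η x • g j x) =
        ((-1 : ℝ) ^ j) • (-∫ x in Ioo (0 : ℝ) 1, η x • g (j + 1) x) := by
      rw [← h2, smul_neg]
    exact (smul_right_injective E (pow_ne_zero j (by norm_num : (-1 : ℝ) ≠ 0))) h3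
  -- Regularity is gained downwards: $g_m$ is a.e. continuous as a primitive of $g_{m+1}$, and each
  -- lower weak derivative gains one order.
  have hreg : ∀ i ≤ m, ∃ F : ℝ → E, ContDiffOn ℝ i F (Icc 0 1) ∧
      g (m - i) =ᵐ[volume.restrict (Ioo 0 1)] F := by
    intro i
    induction i with
    | zero =>
      intro _
      obtain ⟨c, hc⟩ := (hweak m le_rfl).exists_ae_eq_primitive (hgi m (by omega))
        (hgi (m + 1) le_rfl)
      refine ⟨_, ?_, hc⟩
      have := continuousOn_primitive_unitInterval (hgi (m + 1) le_rfl)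
      exact contDiffOn_zero.2 (continuousOn_const.add this)
    | succ i ih =>
      intro hi
      obtain ⟨F, hF, hgF⟩ := ih (by omega)
      have h1 := hweak (m - (i + 1)) (by omega)
      rw [show m - (i + 1) + 1 = m - i by omega] at h1
      exact (h1.congr_right hgF).exists_ae_eq_contDiffOn_succ (hgi _ (by omega)) hF
  obtain ⟨F, hF, hgF⟩ := hreg m le_rfl
  rw [Nat.sub_self] at hgF
  have hu0 : u =ᵐ[volume.restrict (Ioo 0 1)] g 0 :=
    ae_eq_of_forall_isTestFunction hui (hgi 0 (by omega)) fun η hη => by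
      simpa using hg 0 (by omega) η hη.contDiff hη.hasCompactSupport hη.tsupport_subset
  have huF : u =ᵐ[volume.restrict (Icc 0 1)] F := by
    rw [← restrict_Ioo_eq_restrict_Icc]
    exact hu0.trans hgF
  exact hF.congr (Measure.eqOn_Icc_of_ae_eq volume zero_ne_one huF hu hF.continuousOn)

end Sobolev

/-! ### Tangency, injectivity of the flow operator, and the equivalences. -/

section Equivalence

universe v

variable {E : Type v} [NormedAddCommGroup E] [InnerProductSpace ℝ E]

theorem hasJet_of_odd_derivs_eq_zero {F : Type*} [NormedAddCommGroup F] [NormedSpace ℝ F]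
    {S : Set ℝ} {x₀ : ℝ} {m : ℕ} {u : ℝ → F} (hu : ContDiffOn ℝ (2 * m + 1 : ℕ) u S)
    (h : ∀ j < m, iteratedDerivWithin (2 * j + 1) u S x₀ = 0) :
    HasJet S x₀ (2 * m + 1) u (iteratedDerivWithin (2 * m + 1) u S x₀) := by
  refine ⟨hu, fun i hi he => ?_, rfl⟩
  obtain ⟨a, ha⟩ := he
  obtain ⟨b, rfl⟩ : ∃ b, i = 2 * b + 1 := ⟨m - a, by omega⟩
  exact h b (by omega)

/-- If the vanishing of `Q m` is equivalent to that of the derivative of order `2m+1` as soon as the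
lower odd derivatives vanish, then `Q` vanishes up to order `k` if and only if the odd derivatives
do. -/
theorem forall_eq_zero_iff_odd_derivs {F : Type*} [NormedAddCommGroup F] [NormedSpace ℝ F]
    {S : Set ℝ} {x₀ : ℝ} {k : ℕ} {u : ℝ → F} (hu : ContDiffOn ℝ (2 * k + 1 : ℕ) u S)
    {G : Type*} [Zero G] {Q : ℕ → G}
    (hQ : ∀ m ≤ k, ∀ r, HasJet S x₀ (2 * m + 1) u r → (Q m = 0 ↔ r = 0)) :
    (∀ j ≤ k, Q j = 0) ↔ ∀ j ≤ k, iteratedDerivWithin (2 * j + 1) u S x₀ = 0 := by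
  have hu' : ∀ m ≤ k, ContDiffOn ℝ (2 * m + 1 : ℕ) u S := fun m hm =>
    hu.of_le (by norm_cast; omega)
  constructor
  · intro h j
    induction j using Nat.strong_induction_on with
    | _ j ih =>
      intro hj
      exact (hQ j hj _ (hasJet_of_odd_derivs_eq_zero (hu' j hj)
        fun i hi => ih i hi (by omega))).1 (h j hj)
  · intro h j hj
    exact (hQ j hj _ (hasJet_of_odd_derivs_eq_zero (hu' j hj)
      fun i hi => h i (by omega))).2 (h j hj)

theorem covDerivIter_congr {P P' : E → E →L[ℝ] E} {S : Set ℝ} {c : ℝ → E}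
    (h : ∀ x ∈ S, P (c x) = P' (c x)) : ∀ n, EqOn (covDerivIter P S c n) (covDerivIter P' S c n) S
  | 0 => fun _ _ => rfl
  | 1 => fun _ _ => rfl
  | n + 2 => fun x hx => by
      have h1 := covDerivIter_congr h (n + 1)
      simp only [covDerivIter]
      rw [h x hx, derivWithin_congr h1 (h1 hx)]

variable [FiniteDimensional ℝ E] {N : Set E} {J P' J' : E → E →L[ℝ] E}

theorem tangentProj_eq_self {p v : E} (hv : v ∈ tangentSpace N p) : tangentProj N p v = v :=
  Submodule.starProjection_eq_self_iff.2 hv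

/-- The top odd derivative of a curve in `N` is tangent to `N` when the lower ones vanish. -/
theorem HasJet.mem_tangentSpace (hN : IsEmbeddedSubmanifold N) {U : Set E} (hU : IsOpen U)
    (hP : ContDiffOn ℝ ∞ P' U) (hNU : N ⊆ U) (hPN : ∀ p ∈ N, P' p = tangentProj N p) {S : Set ℝ}
    (hS : UniqueDiffOn ℝ S) {x₀ : ℝ} (hx : x₀ ∈ S) {u : ℝ → E} (hu : MapsTo u S N) {m : ℕ} {r : E}
    (h : HasJet S x₀ (2 * m + 1) u r) : r ∈ tangentSpace N (u x₀) := by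
  have h1 : HasJet S x₀ (2 * m) (_root_.derivWithin u S) r := h.derivWithin hS
  have h2 := HasJet.clm_apply hS hx
    (EvenTo.comp hS hx hU hP (hu.mono_right hNU) (h.evenTo (by simp) (by omega))) h1
  -- Velocities are tangent, so $u'=P(u)u'$; comparing derivatives of order $2m$ at $x_0$ gives
  -- $r=P(u(x_0))r$.
  have h3 : EqOn (_root_.derivWithin u S) (fun x => P' (u x) (_root_.derivWithin u S x)) S := by
    intro x hxS
    have := derivWithin_mem_tangentSpace hN hS hu hxS
      (h.1.differentiableOn (by norm_cast) x hxS)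
    simp only
    rw [hPN _ (hu hxS), tangentProj_eq_self this]
  have h4 : P' (u x₀) r = r := (h2.congr hx h3).2.2.symm.trans h1.2.2
  rw [← h4, hPN _ (hu hx)]
  exact Submodule.starProjection_apply_mem _ _

theorem flowOp_apply (hJ : IsSmoothExtension N J P' J') (ε : ℝ) {p v : E}
    (hp : p ∈ N) (hv : v ∈ tangentSpace N p) : flowOp P' J' ε p v = ε • v + J p v := by
  simp [flowOp, hJ.2.1 p hp, tangentProj_eq_self hv, hJ.2.2 p hp v hv]

theorem flowOp_pow_mem (hN : IsKahlerSubmanifold N J) (hJ : IsSmoothExtension N J P' J') (ε : ℝ)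
    {p v : E} (hp : p ∈ N) (hv : v ∈ tangentSpace N p) (m : ℕ) :
    (flowOp P' J' ε p ^ m) v ∈ tangentSpace N p := by
  induction m with
  | zero => simpa using hv
  | succ m ih =>
    rw [pow_succ', mul_apply_eq_comp, flowOp_apply hJ ε hp ih]
    exact Submodule.add_mem _ (Submodule.smul_mem _ _ ih) (hN.mapsTo p hp _ ih)

/-- If $(\varepsilon+J)w=0$ then $Jw=-\varepsilon w$, so $-w=J^2w=\varepsilon^2w$ and
$(\varepsilon^2+1)w=0$. This excludes a kernel for every real $\varepsilon$, including $0$. -/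
theorem flowOp_pow_eq_zero_iff (hN : IsKahlerSubmanifold N J) (hJ : IsSmoothExtension N J P' J')
    (ε : ℝ) {p v : E} (hp : p ∈ N) (hv : v ∈ tangentSpace N p) (m : ℕ) :
    (flowOp P' J' ε p ^ m) v = 0 ↔ v = 0 := by
  induction m with
  | zero => simp
  | succ m ih =>
    refine ⟨fun h => ih.1 ?_, fun h => by simp [h]⟩
    have hw := flowOp_pow_mem hN hJ ε hp hv m
    rw [pow_succ', mul_apply_eq_comp, flowOp_apply hJ ε hp hw] at h
    set w := (flowOp P' J' ε p ^ m) v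
    have h1 : J p w = -(ε • w) := eq_neg_of_add_eq_zero_right h
    have h2 := hN.sq_eq_neg p hp w hw
    rw [h1, map_neg, map_smul, h1, smul_neg, neg_neg, smul_smul] at h2
    have h3 : (ε * ε + 1) • w = 0 := by rw [add_smul, h2, one_smul, neg_add_cancel]
    exact (smul_eq_zero.1 h3).resolve_left (by nlinarith [mul_self_nonneg ε])

theorem proj_pow_apply (hJ : IsSmoothExtension N J P' J') {p v : E} (hp : p ∈ N)
    (hv : v ∈ tangentSpace N p) (n : ℕ) : (P' p ^ n) v = v := by
  induction n with
  | zero => simp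
  | succ n ih =>
    rw [pow_succ', mul_apply_eq_comp, ih, hJ.2.1 p hp, tangentProj_eq_self hv]

/-- Each of the three boundary conditions at a boundary point says that the odd derivatives of `u₀`
vanish there. -/
theorem boundary_conditions_iff (hN : IsKahlerSubmanifold N J) (hJ : IsSmoothExtension N J P' J')
    (ε : ℝ) {k : ℕ} {u₀ : ℝ → E} (hu : MapsTo u₀ (Icc 0 1) N)
    (hreg : ContDiffOn ℝ (2 * k + 1 : ℕ) u₀ (Icc 0 1)) {x₀ : ℝ} (hx : x₀ ∈ Icc (0 : ℝ) 1) :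
    ((∀ j ≤ k, dx (timeDeriv P' J' ε u₀ j) x₀ = 0) ↔
      ∀ j ≤ k, covDx N u₀ (2 * j + 1) x₀ = 0) ∧
    ((∀ j ≤ k, tangentProj N (u₀ x₀) (dx (covTimeDeriv P' J' ε u₀ j) x₀) = 0) ↔
      ∀ j ≤ k, covDx N u₀ (2 * j + 1) x₀ = 0) := by
  obtain ⟨⟨U, hU, hNU, hP, hJ'⟩, hPN, -⟩ := id hJ
  have hS := uniqueDiffOn_unitInterval
  have huU : MapsTo u₀ (Icc 0 1) U := hu.mono_right hNU
  have hT : ∀ {m : ℕ} {r : E}, HasJet (Icc 0 1) x₀ (2 * m + 1) u₀ r →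
      r ∈ tangentSpace N (u₀ x₀) := fun h =>
    h.mem_tangentSpace hN.submanifold hU hP hNU hPN hS hx hu
  have hcov := forall_eq_zero_iff_odd_derivs hreg (x₀ := x₀)
    (Q := fun m => covDx N u₀ (2 * m + 1) x₀) fun m _ r h => by
      have hr : P' (u₀ x₀) r = r := by rw [hPN _ (hu hx), tangentProj_eq_self (hT h)]
      have h1 := (hasJet_covDerivIter hU hP hS hx huU (by simp) h hr (2 * m) le_rfl).2.2
      rw [Nat.sub_self, iteratedDerivWithin_zero] at h1
      rw [covDx, covDerivIter_congr (P' := P') (fun x hx => (hPN _ (hu hx)).symm) _ hx, h1]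
  constructor
  · refine (forall_eq_zero_iff_odd_derivs hreg fun m _ r h => ?_).trans hcov.symm
    rw [dx_timeDeriv hU hP hJ' huU hx h]
    exact flowOp_pow_eq_zero_iff hN hJ ε (hu hx) (hT h) m
  · refine (forall_eq_zero_iff_odd_derivs hreg fun m _ r h => ?_).trans hcov.symm
    have hm := flowOp_pow_mem hN hJ ε (hu hx) (hT h) m
    rw [dx_covTimeDeriv hU hP hJ' huU hx h, proj_pow_apply hJ (hu hx) hm, tangentProj_eq_self hm]
    exact flowOp_pow_eq_zero_iff hN hJ ε (hu hx) (hT h) m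

theorem compatible_iff_and_covCompatible_iff (hN : IsKahlerSubmanifold N J) {k : ℕ} {u₀ : ℝ → E}
    (hu : MemSobolevMaps (2 * k + 2) N u₀) (ε : ℝ) :
    (Compatible N J ε k u₀ ↔
      ∀ j ≤ k, ∀ x ∈ ({0, 1} : Set ℝ), covDx N u₀ (2 * j + 1) x = 0) ∧
    (CovCompatible N J ε k u₀ ↔
      ∀ j ≤ k, ∀ x ∈ ({0, 1} : Set ℝ), covDx N u₀ (2 * j + 1) x = 0) := by
  obtain ⟨hsob, hcont, hmaps⟩ := hu
  have hreg : ContDiffOn ℝ (2 * k + 1 : ℕ) u₀ (Icc 0 1) := hsob.contDiffOn hcont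
  have hI : ∀ x ∈ ({0, 1} : Set ℝ), x ∈ Icc (0 : ℝ) 1 := by
    rintro x (rfl | rfl) <;> simp
  -- One extension suffices to deduce the vanishing of the odd covariant derivatives; the converse
  -- is proved for an arbitrary one.
  obtain ⟨P₀, J₀, h₀⟩ := exists_isSmoothExtension hN
  refine ⟨⟨fun h j hj x hx => ?_, fun h P' J' hJ j hj x hx => ?_⟩,
    ⟨fun h j hj x hx => ?_, fun h P' J' hJ j hj x hx => ?_⟩⟩
  · exact (boundary_conditions_iff hN h₀ ε hmaps hreg (hI x hx)).1.1
      (fun i hi => h P₀ J₀ h₀ i hi x hx) j hj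
  · exact (boundary_conditions_iff hN hJ ε hmaps hreg (hI x hx)).1.2 (fun i hi => h i hi x hx) j hj
  · exact (boundary_conditions_iff hN h₀ ε hmaps hreg (hI x hx)).2.1
      (fun i hi => h P₀ J₀ h₀ i hi x hx) j hj
  · exact (boundary_conditions_iff hN hJ ε hmaps hreg (hI x hx)).2.2 (fun i hi => h i hi x hx) j hj

end Equivalence

end SchrodingerFlow

theorem proposition3p3 {K : ℕ} (N : Set (EuclideanSpace ℝ (Fin K)))
    (J : EuclideanSpace ℝ (Fin K) → EuclideanSpace ℝ (Fin K) →L[ℝ] EuclideanSpace ℝ (Fin K))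
    (hN : SchrodingerFlow.IsKahlerSubmanifold N J)
    (k : ℕ) (u₀ : ℝ → EuclideanSpace ℝ (Fin K))
    (hu₀ : SchrodingerFlow.MemSobolevMaps (2 * k + 2) N u₀) :
    (∀ ε ∈ Set.Icc (0 : ℝ) 1,
      (SchrodingerFlow.Compatible N J ε k u₀ ↔
        ∀ j ≤ k, ∀ x ∈ ({0, 1} : Set ℝ), SchrodingerFlow.covDx N u₀ (2 * j + 1) x = 0) ∧
      (SchrodingerFlow.CovCompatible N J ε k u₀ ↔
        ∀ j ≤ k, ∀ x ∈ ({0, 1} : Set ℝ), SchrodingerFlow.covDx N u₀ (2 * j + 1) x = 0)) ∧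
    (∀ ε ∈ Set.Icc (0 : ℝ) 1, ∀ ε' ∈ Set.Icc (0 : ℝ) 1,
      (SchrodingerFlow.Compatible N J ε k u₀ ↔ SchrodingerFlow.Compatible N J ε' k u₀) ∧
      (SchrodingerFlow.CovCompatible N J ε k u₀ ↔ SchrodingerFlow.CovCompatible N J ε' k u₀)) := by
  have h := SchrodingerFlow.compatible_iff_and_covCompatible_iff hN hu₀
  exact ⟨fun ε _ => h ε, fun ε _ ε' _ =>
    ⟨(h ε).1.trans (h ε').1.symm, (h ε).2.trans (h ε').2.symm⟩⟩
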